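/- Let $\alpha>0$. Let $L^2_{o,p}$ be the space of odd functions in $L^2(-\pi,\pi)$ (extended $2\pi$-periodically to $\mathbb R$), with norm $\|\cdot\|$ and inner product $(f,g)=\int_{-\pi}^{\pi}fg\,dx$, and let $H^1_{o,p}$ be the set of $f\in L^2_{o,p}$ whose distributional derivative $f'$ on the circle $\mathbb R/2\pi\mathbb Z$ is in $L^2$. Let $A f=-\alpha f''-2f$ with domain $D(A)=\{f\in L^2_{o,p}: Af\in L^2_{o,p}\}$, where $f''$ is the second distributional derivative on the circle; its eigenvalues are $\lambda_n=\alpha n^2-2$, $n=1,2,\dots$, with orthonormal eigenfunctions $\varphi_n(x)=\pi^{-1/2}\sin nx$. Fix $a\in\mathbb R$ with $\alpha+a>2$ (so $a=0$ is allowed if $\alpha>2$), put $A_1=A+aI$, and let $\mathcal B^{1/2}=D(A_1^{1/2})=\{f\in L^2_{o,p}:\sum_{n\ge1}(\lambda_n+a)(f,\varphi_n)^2<\infty\}$, with the norm $\|f\|_{1/2}=\|A_1^{1/2}f\|=\big(\sum_{n\ge1}(\lambda_n+a)(f,\varphi_n)^2\big)^{1/2}$. Then $\mathcal B^{1/2}=H^1_{o,p}$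 as sets, and for every $z_0\in\mathcal B^{1/2}$ the initial value problem $$\frac{dz}{dt}+Az=-2\alpha\,z\,z',\qquad z(0)=z_0,$$ has a unique solution $z(t)$ for all $t\ge0$. Here a solution is a continuous map $z:[0,\infty)\to\mathcal B^{1/2}$ with $z(0)=z_0$ such that for every $t>0$ one has $z(t)\in D(A)$, $z$ is differentiable at $t$ as a map into $L^2(-\pi,\pi)$, and the equation holds in $L^2(-\pi,\pi)$. In addition, if $\|z(t)\|_{1/2}$ is bounded as $t\to\infty$, then the trajectory $\{z(t)\}_{t\ge0}$ lies in a compact subset of $\mathcal B^{1/2}$. -/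

import Mathlib

open MeasureTheory Set Filter Topology
open scoped ContDiff ENNReal

noncomputable section

namespace OddBurgers

/-- Lebesgue measure on the interval `(-π, π)`. -/
abbrev mu : Measure ℝ := volume.restrict (Ioo (-Real.pi) Real.pi)

/-- The real Hilbert space `L²(-π, π)`, with inner product `(f, g) = ∫ f g` over `(-π, π)`. -/
abbrev L2 : Type := Lp ℝ 2 mu

theorem measurePreserving_neg_mu : MeasurePreserving (fun x : ℝ => -x) mu mu := by
  have h := (Measure.measurePreserving_neg (volume : Measure ℝ)).restrict_preimage
    (s := Ioo (-Real.pi) Real.pi) measurableSet_Ioo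
  simpa using h

/-- `L²_{o,p}(-π, π)`: the closed subspace of odd classes. (Every function on `(-π, π)` is the
restriction of a `2π`-periodic one, up to null sets, so periodicity is no restriction here; it
enters through the test functions of the weak derivatives.) -/
def L2op : Submodule ℝ L2 where
  carrier := {f | ∀ᵐ x ∂mu, f (-x) = -f x}
  zero_mem' := by
    have h0 := Lp.coeFn_zero ℝ 2 mu
    have h1 := measurePreserving_neg_mu.quasiMeasurePreserving.ae h0
    change ∀ᵐ x ∂mu, (0 : L2) (-x) = -(0 : L2) x
    filter_upwards [h0, h1] with x hx hx'
    rw [hx, hx', Pi.zero_apply, Pi.zero_apply, neg_zero]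
  add_mem' := by
    intro f g hf hg
    have h0 := Lp.coeFn_add f g
    have h1 := measurePreserving_neg_mu.quasiMeasurePreserving.ae h0
    change ∀ᵐ x ∂mu, (f + g : L2) (-x) = -(f + g : L2) x
    filter_upwards [h0, h1, hf, hg] with x hx hx' hfx hgx
    rw [hx, hx', Pi.add_apply, Pi.add_apply, hfx, hgx, neg_add]
  smul_mem' := by
    intro c f hf
    have h0 := Lp.coeFn_smul c f
    have h1 := measurePreserving_neg_mu.quasiMeasurePreserving.ae h0
    change ∀ᵐ x ∂mu, (c • f : L2) (-x) = -(c • f : L2) x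
    filter_upwards [h0, h1, hf] with x hx hx' hfx
    rw [hx, hx', Pi.smul_apply, Pi.smul_apply, hfx, smul_neg]

/-- Smooth `2π`-periodic test functions. -/
def IsTest (φ : ℝ → ℝ) : Prop :=
  ContDiff ℝ ∞ φ ∧ Function.Periodic φ (2 * Real.pi)

/-- `g` is the distributional derivative of `f` on the circle `ℝ / 2πℤ`. -/
def IsWeakDeriv (f g : L2) : Prop :=
  ∀ φ : ℝ → ℝ, IsTest φ → ∫ x, f x * deriv φ x ∂mu = -∫ x, g x * φ x ∂mu

/-- `h` is the second distributional derivative of `f` on the circle `ℝ / 2πℤ`. -/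
def IsWeakDeriv₂ (f h : L2) : Prop :=
  ∀ φ : ℝ → ℝ, IsTest φ → ∫ x, f x * deriv (deriv φ) x ∂mu = ∫ x, h x * φ x ∂mu

/-- The Sobolev space `H¹_{o,p}(-π, π)` of odd periodic functions, as a subset of `L²(-π, π)`. -/
def H1op : Set L2 := {f | f ∈ L2op ∧ ∃ g : L2, IsWeakDeriv f g}

/-- `f ∈ D(A)` and `A f = y`, where `A f = -α f'' - 2 f` and
`D(A) = {f ∈ L²_{o,p} : A f ∈ L²_{o,p}}`. (If `f` is odd, so is `f''`.) -/
def IsA (α : ℝ) (f y : L2) : Prop :=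
  f ∈ L2op ∧ ∃ h : L2, IsWeakDeriv₂ f h ∧ y = -(α • h) - (2 : ℝ) • f

/-- The nonlinearity is defined at `f`, with value `y = F(f) = -2 α f f'` in `L²`. -/
def IsF (α : ℝ) (f y : L2) : Prop :=
  ∃ g : L2, IsWeakDeriv f g ∧ ∀ᵐ x ∂mu, y x = -2 * α * f x * g x

/-- The eigenvalues `λ_k = α k² - 2`, `k = 1, 2, …`, of `A`, indexed by `n = k - 1`. -/
def eigenvalue (α : ℝ) (n : ℕ) : ℝ := α * ((n : ℝ) + 1) ^ 2 - 2

theorem memLp_sine (n : ℕ) :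
    MemLp (fun x : ℝ => √(1 / Real.pi) * Real.sin (((n : ℝ) + 1) * x)) 2 mu := by
  refine MemLp.of_bound (C := √(1 / Real.pi))
    (Continuous.aestronglyMeasurable (by fun_prop)) (ae_of_all _ fun x => ?_)
  rw [norm_mul, Real.norm_of_nonneg (Real.sqrt_nonneg _), Real.norm_eq_abs]
  exact mul_le_of_le_one_right (Real.sqrt_nonneg _) (Real.abs_sin_le_one _)

/-- The orthonormal eigenfunctions `φ_k(x) = (1/π)^{1/2} sin (k x)`, indexed by `n = k - 1`. -/
def eigenfunction (n : ℕ) : L2 := (memLp_sine n).toLp _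

/-- The coordinates `((λ_k + a)^γ (φ_k, f))_k` of `(A + a)^γ f` in the orthonormal basis `φ_k` of
`L²_{o,p}`. -/
def powCoeff (α a γ : ℝ) (f : L2) (n : ℕ) : ℝ :=
  (eigenvalue α n + a) ^ γ * inner ℝ (eigenfunction n) f

/-- The domain `D(A₁^γ)` in `L²_{o,p}` of the fractional power of `A₁ = A + a`. -/
def powDomain (α a γ : ℝ) : Submodule ℝ L2 where
  carrier := {f | f ∈ L2op ∧ Memℓp (E := fun _ : ℕ => ℝ) (powCoeff α a γ f) 2}
  zero_mem' := by
    refine ⟨L2op.zero_mem, ?_⟩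
    have : powCoeff α a γ 0 = 0 := by funext n; simp [powCoeff]
    rw [this]; exact zero_memℓp
  add_mem' := by
    intro f g hf hg
    refine ⟨L2op.add_mem hf.1 hg.1, ?_⟩
    have : powCoeff α a γ (f + g) = powCoeff α a γ f + powCoeff α a γ g := by
      funext n; simp [powCoeff, inner_add_right, mul_add]
    rw [this]; exact hf.2.add hg.2
  smul_mem' := by
    intro c f hf
    refine ⟨L2op.smul_mem c hf.1, ?_⟩
    have : powCoeff α a γ (c • f) = c • powCoeff α a γ f := by
      funext n; simp [powCoeff, inner_smul_right]; ring
    rw [this]; exact hf.2.const_smul c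

/-- The space `B^γ = D(A₁^γ)`, `A₁ = A + a`, which carries the norm `‖f‖_γ = ‖A₁^γ f‖` (and not
the norm of `L²`). -/
def B (α a γ : ℝ) : Type := powDomain α a γ

instance (α a γ : ℝ) : AddCommGroup (B α a γ) := inferInstanceAs (AddCommGroup (powDomain α a γ))

instance (α a γ : ℝ) : Module ℝ (B α a γ) := inferInstanceAs (Module ℝ (powDomain α a γ))

/-- The inclusion of `B^γ` in `L²`. -/
def B.toL2 {α a γ : ℝ} : B α a γ →ₗ[ℝ] L2 := (powDomain α a γ).subtype

/-- The operator `A₁^γ` on `B^γ`, its values being written in the orthonormal basis `φ_k`. -/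
def B.pow {α a γ : ℝ} : B α a γ →ₗ[ℝ] lp (fun _ : ℕ => ℝ) 2 where
  toFun f := ⟨powCoeff α a γ f.toL2, f.2.2⟩
  map_add' f g := by
    ext n
    change powCoeff α a γ (f + g).toL2 n = powCoeff α a γ f.toL2 n + powCoeff α a γ g.toL2 n
    simp [powCoeff, inner_add_right, mul_add]
  map_smul' c f := by
    ext n
    change powCoeff α a γ (c • f).toL2 n = c * powCoeff α a γ f.toL2 n
    simp [powCoeff, inner_smul_right]
    ring

/-- The norm `‖f‖_γ = ‖A₁^γ f‖`. (It is definite as soon as all `λ_k + a` are positive, i.e. when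
`2 < α + a`.) -/
instance (α a γ : ℝ) : SeminormedAddCommGroup (B α a γ) :=
  SeminormedAddCommGroup.induced _ _ (B.pow (α := α) (a := a) (γ := γ))

instance (α a γ : ℝ) : NormedSpace ℝ (B α a γ) :=
  NormedSpace.induced _ _ _ (B.pow (α := α) (a := a) (γ := γ))

/-- `z : [0, ∞) → B^{1/2}` solves `dz/dt + A z = F(z)`, `z(0) = z₀`: it is continuous into `B^{1/2}`
on `[0, ∞)`, and for every `t > 0` it has a derivative in `L²`, `z(t) ∈ D(A)`, and the equation
holds in `L²`. The values at negative times are irrelevant. -/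
structure IsSolution (α a : ℝ) (z₀ : B α a (1 / 2)) (z : ℝ → B α a (1 / 2)) : Prop where
  initial : z 0 = z₀
  continuousOn : ContinuousOn z (Ici 0)
  equation : ∀ t : ℝ, 0 < t → ∃ v Az Fz : L2,
    HasDerivAt (fun s => (z s).toL2) v t ∧ IsA α (z t).toL2 Az ∧ IsF α (z t).toL2 Fz ∧
      v + Az = Fz

end OddBurgers

end

/-! In the coordinates $y_n=\sigma_n(z,\varphi_n)$, $\sigma_n=(\lambda_n+a)^{1/2}$, the space
$\mathcal B^{1/2}$ becomes $\ell^2$ and the equation becomes $y_n'=-\sigma_n^2y_n+\sigma_nf_n$,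
where $f$ is the sine coefficient sequence of $-2\alpha zz'+az$. Since $H^1$ embeds in the bounded
functions, $(z,w)\mapsto zw'$ is bounded and bilinear from $\mathcal B^{1/2}$ to $L^2$, so $f$ is a
locally Lipschitz function of $y$ with values in $\ell^2$.

Completing the square in each mode gives $\|y(t)\|^2\le\|y(s)\|^2+\frac12\int_s^t\|f\|^2$
(`IsMild.norm_sq_le`). This single estimate yields uniqueness, and Picard iteration for a truncated
nonlinearity. Solutions are global because $\int z\cdot zz'=\int(z^3/3)'=0$
(`inner_primitiveMul_self`): the energy identity bounds $\|z\|$ and $\int\|y\|^2$, and Gronwall with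
the integrable kernel $\|y\|^2$ then bounds $\|y\|$ on every $[0,T]$ (`exists_apriori_bound`), so
the truncation is never felt.

Smoothing by the semigroup makes $y$ Hölder continuous in time at positive times. Hence $f-A_1z$,
known at first only mode by mode, is a continuous curve in $\ell^2$, so $z$ is differentiable in
$L^2$ with values in $D(A)$ (`IsMild.exists_hasDerivAt`). Conversely, every solution has mild
coordinates, so uniqueness transfers. For a bounded trajectory, damping of the high modes over a
short fixed time makes the tails of $y(t)$ uniformly small, which gives compactness
(`exists_isCompact_of_isMild`). -/

namespace OddBurgers

/-! ### The sequence space `ℓ²` -/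

/-- The real Hilbert space `ℓ²(ℕ)`. -/
abbrev ell2 : Type := lp (fun _ : ℕ => ℝ) 2

namespace ell2

theorem hasSum_sq (x : ell2) : HasSum (fun n => x n ^ 2) (‖x‖ ^ 2) := by
  have h := lp.hasSum_inner (𝕜 := ℝ) x x
  rw [real_inner_self_eq_norm_sq] at h
  simpa using h

theorem sum_sq_le (x : ell2) (s : Finset ℕ) : ∑ n ∈ s, x n ^ 2 ≤ ‖x‖ ^ 2 :=
  sum_le_hasSum s (fun _ _ => sq_nonneg _) x.hasSum_sq

theorem norm_sq_le_of_sum_le {x : ell2} {C : ℝ}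
    (h : ∀ N, ∑ n ∈ Finset.range N, x n ^ 2 ≤ C) : ‖x‖ ^ 2 ≤ C :=
  le_of_tendsto' x.hasSum_sq.tendsto_sum_nat h

theorem memℓp_of_sum_le {c : ℕ → ℝ} {C : ℝ}
    (h : ∀ N, ∑ n ∈ Finset.range N, c n ^ 2 ≤ C) : Memℓp (E := fun _ : ℕ => ℝ) c 2 := by
  rw [memℓp_gen_iff (by norm_num)]
  have : Summable fun n => c n ^ 2 := summable_of_sum_range_le (fun n => sq_nonneg _) h
  simpa using this

theorem continuous_coord (n : ℕ) : Continuous fun x : ell2 => x n :=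
  (lp.evalCLM ℝ (fun _ : ℕ => ℝ) 2 n).continuous

/-- Past `N`, $(x_n-y_n)^2\le2x_n^2+2y_n^2$, so each tail costs $2\varepsilon$ and a
finite-dimensional comparison remains. -/
theorem norm_sub_sq_le {x y : ell2} {N : ℕ} {ε : ℝ}
    (hx : ∀ M, ∑ n ∈ Finset.Ico N M, x n ^ 2 ≤ ε) (hy : ∀ M, ∑ n ∈ Finset.Ico N M, y n ^ 2 ≤ ε) :
    ‖x - y‖ ^ 2 ≤ ∑ n ∈ Finset.range N, (x n - y n) ^ 2 + 4 * ε := by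
  refine le_of_tendsto (x - y).hasSum_sq.tendsto_sum_nat ?_
  filter_upwards [eventually_ge_atTop N] with M hM
  rw [← Finset.sum_range_add_sum_Ico _ hM]
  have : ∑ n ∈ Finset.Ico N M, (x - y) n ^ 2
      ≤ ∑ n ∈ Finset.Ico N M, (2 * x n ^ 2 + 2 * y n ^ 2) := by
    refine Finset.sum_le_sum fun n _ => ?_
    rw [lp.coeFn_sub, Pi.sub_apply]
    nlinarith [sq_nonneg (x n + y n)]
  rw [Finset.sum_add_distrib, ← Finset.mul_sum, ← Finset.mul_sum] at this
  have h1 := hx M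
  have h2 := hy M
  simp only [lp.coeFn_sub, Pi.sub_apply] at this ⊢
  linarith

theorem continuousOn_of_uniform_tails {X : Type*} [TopologicalSpace X] {s : Set X} {g : X → ell2}
    (hc : ∀ n, ContinuousOn (fun x => g x n) s)
    (ht : ∀ ε > 0, ∃ N, ∀ x ∈ s, ∀ M, ∑ n ∈ Finset.Ico N M, g x n ^ 2 ≤ ε) :
    ContinuousOn g s := by
  intro x hx
  rw [ContinuousWithinAt, tendsto_iff_norm_sub_tendsto_zero]
  have key : Tendsto (fun y => ‖g y - g x‖ ^ 2) (𝓝[s] x) (𝓝 0) := by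
    rw [Metric.tendsto_nhds]
    intro ε hε
    obtain ⟨N, hN⟩ := ht (ε / 8) (by positivity)
    have h1 : Tendsto (fun y => ∑ n ∈ Finset.range N, (g y n - g x n) ^ 2) (𝓝[s] x) (𝓝 0) := by
      have := tendsto_finsetSum (Finset.range N) fun n _ =>
        (((hc n x hx).tendsto.sub_const (g x n)).pow 2)
      simpa using this
    filter_upwards [h1.eventually (gt_mem_nhds (show (0 : ℝ) < ε / 2 by positivity)),
      self_mem_nhdsWithin] with y hy hys
    have := norm_sub_sq_le (hN y hys) (hN x hx)
    rw [Real.dist_0_eq_abs, abs_of_nonneg (by positivity)]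
    linarith
  have := key.sqrt
  simpa [Real.sqrt_sq] using this

/-- A bounded set of first coordinates is totally bounded in finite dimension; a finite net there
lifts to `s`, and the tails are uniformly negligible. -/
theorem totallyBounded_of_uniform_tails {s : Set ell2} {R : ℝ} (hb : ∀ x ∈ s, ‖x‖ ≤ R)
    (ht : ∀ ε > 0, ∃ N, ∀ x ∈ s, ∀ M, ∑ n ∈ Finset.Ico N M, x n ^ 2 ≤ ε) :
    TotallyBounded s := by
  rw [Metric.totallyBounded_iff]
  intro ε hε
  -- With an $\varepsilon/2$-net of the projections, the total is
  -- $(\varepsilon/2)^2+4\cdot\varepsilon^2/8<\varepsilon^2$.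
  obtain ⟨N, hN⟩ := ht (ε ^ 2 / 8) (by positivity)
  let p : ell2 → EuclideanSpace ℝ (Fin N) := fun x => WithLp.toLp 2 fun i => x i
  have hp : ∀ x y : ell2, ‖p x - p y‖ ^ 2 = ∑ n ∈ Finset.range N, (x n - y n) ^ 2 := by
    intro x y
    rw [EuclideanSpace.norm_sq_eq, Finset.sum_range]
    simp [p]
  have hbd : Bornology.IsBounded (p '' s) := by
    rw [isBounded_iff_forall_norm_le]
    refine ⟨R, ?_⟩
    rintro _ ⟨x, hx, rfl⟩
    have h1 := hp x 0
    have h0 : p 0 = 0 := by ext i; simp [p]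
    simp only [h0, sub_zero, lp.coeFn_zero, Pi.zero_apply] at h1
    have h2 := x.sum_sq_le (Finset.range N)
    rw [← h1] at h2
    exact (abs_le_of_sq_le_sq' h2 (norm_nonneg _)).2.trans (hb x hx)
  have htb : TotallyBounded (p '' s) :=
    (hbd.isCompact_closure.totallyBounded).subset subset_closure
  obtain ⟨t, hts, htf, hcov⟩ := htb.exists_subset (Metric.dist_mem_uniformity
    (show (0 : ℝ) < ε / 2 by positivity))
  -- The centres must come from points of `s`, because the tail bound is available only there.
  obtain ⟨t', ht's, ht'f, ht'⟩ : ∃ t' ⊆ s, t'.Finite ∧ p '' t' = t := by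
    exact (exists_subset_image_finite_and (p := fun u => u = t)).1 ⟨t, hts, htf, rfl⟩
  refine ⟨t', ht'f, fun x hx => ?_⟩
  obtain ⟨_, hy, hxy⟩ := mem_iUnion₂.1 (hcov (mem_image_of_mem p hx))
  rw [← ht'] at hy
  obtain ⟨y, hy, rfl⟩ := hy
  refine mem_iUnion₂.2 ⟨y, hy, ?_⟩
  have h1 := norm_sub_sq_le (hN x hx) (hN y (ht's hy))
  rw [← hp] at h1
  have h2 : ‖p x - p y‖ < ε / 2 := by simpa [dist_eq_norm] using hxy
  have h3 : ‖p x - p y‖ ^ 2 < (ε / 2) ^ 2 := by gcongr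
  rw [Metric.mem_ball, dist_eq_norm]
  refine lt_of_pow_lt_pow_left₀ 2 hε.le ?_
  nlinarith

/-- The sum of squares of the coordinates from the `N`-th on. -/
noncomputable def tailSq (N : ℕ) (x : ell2) : ℝ := ‖x‖ ^ 2 - ∑ n ∈ Finset.range N, x n ^ 2

theorem continuous_tailSq (N : ℕ) : Continuous (tailSq N) :=
  (continuous_norm.pow 2).sub (continuous_finsetSum _ fun n _ => (continuous_coord n).pow 2)

theorem tailSq_nonneg (N : ℕ) (x : ell2) : 0 ≤ tailSq N x := sub_nonneg.2 (x.sum_sq_le _)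

theorem tailSq_le (N : ℕ) (x : ell2) : tailSq N x ≤ ‖x‖ ^ 2 :=
  sub_le_self _ (Finset.sum_nonneg fun _ _ => sq_nonneg _)

theorem sum_Ico_le_tailSq (N M : ℕ) (x : ell2) : ∑ n ∈ Finset.Ico N M, x n ^ 2 ≤ tailSq N x := by
  rcases le_total N M with h | h
  · rw [tailSq, le_sub_iff_add_le, add_comm, Finset.sum_range_add_sum_Ico _ h]
    exact x.sum_sq_le _
  · rw [Finset.Ico_eq_empty_of_le h, Finset.sum_empty]
    exact tailSq_nonneg N x

theorem tendsto_tailSq (x : ell2) : Tendsto (fun N => tailSq N x) atTop (𝓝 0) := by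
  have := (tendsto_const_nhds (x := ‖x‖ ^ 2)).sub x.hasSum_sq.tendsto_sum_nat
  simpa [tailSq] using this

theorem tendsto_integral_tailSq {f : ℝ → ell2} (hf : Continuous f) (s t : ℝ) :
    Tendsto (fun N => ∫ r in s..t, tailSq N (f r)) atTop (𝓝 0) := by
  have h := intervalIntegral.tendsto_integral_filter_of_dominated_convergence (μ := volume)
    (a := s) (b := t) (l := atTop) (F := fun N r => tailSq N (f r)) (f := fun _ => (0 : ℝ))
    (fun r => ‖f r‖ ^ 2)
    (Eventually.of_forall fun N => ((continuous_tailSq N).comp hf).aestronglyMeasurable)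
    (Eventually.of_forall fun N => ae_of_all _ fun r _ => by
      rw [Real.norm_of_nonneg (tailSq_nonneg _ _)]; exact tailSq_le _ _)
    ((hf.norm.pow 2).intervalIntegrable _ _)
    (ae_of_all _ fun r _ => tendsto_tailSq _)
  simpa using h

/-- The diagonal operator on `ℓ²` with the bounded symbol `d`. -/
noncomputable def diag (d : ℕ → ℝ) (C : ℝ) (h : ∀ n, |d n| ≤ C) : ell2 →L[ℝ] ell2 :=
  have hb : ∀ (x : ell2) (N : ℕ), ∑ n ∈ Finset.range N, (d n * x n) ^ 2 ≤ (C * ‖x‖) ^ 2 := by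
    intro x N
    calc _ ≤ ∑ n ∈ Finset.range N, C ^ 2 * x n ^ 2 := Finset.sum_le_sum fun n _ => by
          rw [mul_pow]
          exact mul_le_mul_of_nonneg_right (sq_le_sq' (neg_le_of_abs_le (h n))
            (le_of_abs_le (h n))) (sq_nonneg _)
      _ ≤ _ := by
          rw [← Finset.mul_sum, mul_pow]
          exact mul_le_mul_of_nonneg_left (x.sum_sq_le _) (sq_nonneg _)
  LinearMap.mkContinuous
    { toFun := fun x => ⟨fun n => d n * x n, memℓp_of_sum_le (hb x)⟩
      map_add' := fun x y => by ext n; exact mul_add _ _ _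
      map_smul' := fun c x => by ext n; exact mul_left_comm _ _ _ } C fun x => by
    have hC : 0 ≤ C := (abs_nonneg _).trans (h 0)
    exact (abs_le_of_sq_le_sq' (norm_sq_le_of_sum_le (hb x)) (by positivity)).2

theorem diag_apply (d : ℕ → ℝ) (C : ℝ) (h : ∀ n, |d n| ≤ C) (x : ell2) (n : ℕ) :
    diag d C h x n = d n * x n := rfl

theorem norm_diag_le (d : ℕ → ℝ) (C : ℝ) (h : ∀ n, |d n| ≤ C) (x : ell2) :
    ‖diag d C h x‖ ≤ C * ‖x‖ :=
  (diag d C h).le_of_opNorm_le (by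
    unfold diag; exact LinearMap.mkContinuous_norm_le _ ((abs_nonneg _).trans (h 0)) _) x

theorem norm_sq_le_add_integral {x y : ell2} {f : ℝ → ell2} (hf : Continuous f) {s t K : ℝ}
    (hst : s ≤ t) (hK : 0 ≤ K) (h : ∀ n, x n ^ 2 ≤ y n ^ 2 + K * ∫ r in s..t, f r n ^ 2) :
    ‖x‖ ^ 2 ≤ ‖y‖ ^ 2 + K * ∫ r in s..t, ‖f r‖ ^ 2 := by
  refine norm_sq_le_of_sum_le fun N => ?_
  have hi : ∀ n, IntervalIntegrable (fun r => f r n ^ 2) volume s t := fun n =>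
    (((continuous_coord n).comp hf).pow 2).intervalIntegrable _ _
  calc _ ≤ ∑ n ∈ Finset.range N, (y n ^ 2 + K * ∫ r in s..t, f r n ^ 2) :=
        Finset.sum_le_sum fun n _ => h n
    _ = ∑ n ∈ Finset.range N, y n ^ 2 + K * ∫ r in s..t, ∑ n ∈ Finset.range N, f r n ^ 2 := by
        rw [Finset.sum_add_distrib, ← Finset.mul_sum,
          intervalIntegral.integral_finsetSum fun n _ => hi n]
    _ ≤ _ := by
        refine add_le_add (y.sum_sq_le _) (mul_le_mul_of_nonneg_left ?_ hK)
        exact intervalIntegral.integral_mono_on hst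
          ((continuous_finsetSum _ fun n _ =>
            ((continuous_coord n).comp hf).pow 2).intervalIntegrable _ _)
          ((hf.norm.pow 2).intervalIntegrable _ _) fun r _ => (f r).sum_sq_le _

end ell2

/-! ### Scalar linear equations -/

theorem sub_eq_integral_of_ode {u F : ℝ → ℝ} {s t : ℝ} (hst : s ≤ t) (hu : ContinuousOn u (Icc s t))
    (hF : Continuous F) (h : ∀ r ∈ Ioo s t, HasDerivAt u (F r) r) :
    u t - u s = ∫ r in s..t, F r :=
  (intervalIntegral.integral_eq_sub_of_hasDerivAt_of_le hst hu h (hF.intervalIntegrable _ _)).symm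

/-- $(u^2)'=-2\sigma^2u^2+2\sigma ug=\frac12g^2-\frac12(2\sigma u-g)^2$. The constant does not
depend on $\sigma$, so the modes can be summed although the forcing $\sigma g$ carries an unbounded
factor. -/
theorem sq_le_of_ode {u g : ℝ → ℝ} {σ s t : ℝ} (hst : s ≤ t) (hu : Continuous u)
    (hg : Continuous g)
    (h : ∀ r ∈ Ioo s t, HasDerivAt u (-(σ ^ 2) * u r + σ * g r) r) :
    u t ^ 2 ≤ u s ^ 2 + 1 / 2 * ∫ r in s..t, g r ^ 2 := by
  have h1 := sub_eq_integral_of_ode (u := fun r => u r ^ 2)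
    (F := fun r => 2 * u r * (-(σ ^ 2) * u r + σ * g r)) hst (by fun_prop) (by fun_prop)
    fun r hr => ((h r hr).fun_pow 2).congr_deriv (by simp)
  have h2 : ∫ r in s..t, 2 * u r * (-(σ ^ 2) * u r + σ * g r) ≤ ∫ r in s..t, 1 / 2 * g r ^ 2 := by
    refine intervalIntegral.integral_mono_on hst (Continuous.intervalIntegrable (by fun_prop) _ _)
      (Continuous.intervalIntegrable (by fun_prop) _ _) fun r _ => ?_
    nlinarith [sq_nonneg (2 * σ * u r - g r)]
  rw [intervalIntegral.integral_const_mul] at h2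
  linarith

/-- Subtracting the free evolution leaves a solution with the same forcing that vanishes at `s`. -/
theorem sub_exp_sq_le_of_ode {u g : ℝ → ℝ} {σ s t : ℝ} (hst : s ≤ t) (hu : Continuous u)
    (hg : Continuous g)
    (h : ∀ r ∈ Ioo s t, HasDerivAt u (-(σ ^ 2) * u r + σ * g r) r) :
    (u t - Real.exp (-(σ ^ 2) * (t - s)) * u s) ^ 2 ≤ 1 / 2 * ∫ r in s..t, g r ^ 2 := by
  have := sq_le_of_ode (u := fun r => u r - Real.exp (-(σ ^ 2) * (r - s)) * u s) (σ := σ) hst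
    (by fun_prop) hg fun r hr => by
      have h1 : HasDerivAt (fun r => Real.exp (-(σ ^ 2) * (r - s)) * u s)
          (Real.exp (-(σ ^ 2) * (r - s)) * (-(σ ^ 2) * 1) * u s) r :=
        ((((hasDerivAt_id r).sub_const s).const_mul _).exp).mul_const _
      exact ((h r hr).fun_sub h1).congr_deriv (by ring)
  simpa using this

theorem variation_of_constants {u g : ℝ → ℝ} {σ s t : ℝ} (hst : s ≤ t) (hu : Continuous u)
    (hg : Continuous g)
    (h : ∀ r ∈ Ioo s t, HasDerivAt u (-(σ ^ 2) * u r + σ * g r) r) :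
    u t = Real.exp (-(σ ^ 2) * (t - s)) * u s +
      σ * ∫ r in s..t, Real.exp (-(σ ^ 2) * (t - r)) * g r := by
  have h1 := sub_eq_integral_of_ode (u := fun r => Real.exp (-(σ ^ 2) * (t - r)) * u r)
    (F := fun r => σ * (Real.exp (-(σ ^ 2) * (t - r)) * g r)) hst (by fun_prop) (by fun_prop)
    fun r hr => by
      have h1 : HasDerivAt (fun r => Real.exp (-(σ ^ 2) * (t - r)))
          (Real.exp (-(σ ^ 2) * (t - r)) * (-(σ ^ 2) * (-1))) r :=
        (((hasDerivAt_id r).const_sub t).const_mul _).exp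
      exact (h1.fun_mul (h r hr)).congr_deriv (by ring)
  rw [intervalIntegral.integral_const_mul] at h1
  simp only [sub_self, mul_zero, Real.exp_zero, one_mul] at h1
  linarith

/-- Gronwall's inequality in integral form. -/
theorem gronwall_integral {u k : ℝ → ℝ} {c T : ℝ} (hu : Continuous u) (hk : Continuous k)
    (hk0 : ∀ t, 0 ≤ k t) (h : ∀ t ∈ Icc 0 T, u t ≤ c + ∫ r in (0 : ℝ)..t, k r * u r) :
    ∀ t ∈ Icc 0 T, u t ≤ c * Real.exp (∫ r in (0 : ℝ)..t, k r) := by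
  intro t ht
  set U : ℝ → ℝ := fun t => c + ∫ r in (0 : ℝ)..t, k r * u r
  set K : ℝ → ℝ := fun t => ∫ r in (0 : ℝ)..t, k r
  have hU : ∀ t, HasDerivAt U (k t * u t) t := fun t =>
    ((hk.mul hu).integral_hasStrictDerivAt 0 t).hasDerivAt.const_add c
  have hK : ∀ t, HasDerivAt K (k t) t := fun t => (hk.integral_hasStrictDerivAt 0 t).hasDerivAt
  have hW : ∀ t, HasDerivAt (fun t => U t * Real.exp (-K t))
      (k t * u t * Real.exp (-K t) + U t * (Real.exp (-K t) * -k t)) t := fun t =>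
    (hU t).mul (hK t).neg.exp
  have hanti : AntitoneOn (fun t => U t * Real.exp (-K t)) (Icc 0 T) := by
    refine antitoneOn_of_deriv_nonpos (convex_Icc 0 T)
      (fun t _ => (hW t).continuousAt.continuousWithinAt)
      (fun t _ => (hW t).differentiableAt.differentiableWithinAt) fun t ht => ?_
    rw [interior_Icc] at ht
    rw [(hW t).deriv]
    have := mul_le_mul_of_nonneg_left (h t (Ioo_subset_Icc_self ht))
      (mul_nonneg (hk0 t) (Real.exp_pos (-K t)).le)
    simp only [U] at this ⊢
    nlinarith
  have h0 := hanti ⟨le_rfl, ht.1.trans ht.2⟩ ht ht.1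
  have h1 : U t ≤ c * Real.exp (K t) := by
    simp only [U, K, intervalIntegral.integral_same, neg_zero, Real.exp_zero, add_zero,
      mul_one] at h0
    rw [Real.exp_neg, ← div_eq_mul_inv, div_le_iff₀ (Real.exp_pos _)] at h0
    exact h0
  exact (h t ht).trans h1

section LinearEvolution

/-! ### Diagonal linear evolution equations in `ℓ²` -/

/-- The continuous curve `y` in `ℓ²` solves, in the coordinates `y = A₁^{1/2} z`, the equation
`dz/dt + A₁ z = f` on `(0, T)`, where `A₁` is diagonal with entries `σ n ^ 2`. -/
def IsMild (σ : ℕ → ℝ) (T : ℝ) (y f : ℝ → ell2) : Prop :=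
  ∀ t ∈ Ioo 0 T, ∀ n, HasDerivAt (fun s => y s n) (-(σ n ^ 2) * y t n + σ n * f t n) t

/-- The semigroup generated by the diagonal operator with entries `-σ n ^ 2`. -/
noncomputable def heat (σ : ℕ → ℝ) (τ : ℝ) : ell2 →L[ℝ] ell2 :=
  -- `max τ 0` keeps the symbol bounded by 1 for every real `τ`.
  ell2.diag (fun n => Real.exp (-(σ n ^ 2) * max τ 0)) 1 fun n => by
    rw [abs_of_pos (Real.exp_pos _), Real.exp_le_one_iff, neg_mul, neg_nonpos]
    positivity

theorem heat_apply (σ : ℕ → ℝ) {τ : ℝ} (hτ : 0 ≤ τ) (x : ell2) (n : ℕ) :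
    heat σ τ x n = Real.exp (-(σ n ^ 2) * τ) * x n := by
  rw [heat, ell2.diag_apply, max_eq_left hτ]

theorem norm_heat_le (σ : ℕ → ℝ) (τ : ℝ) (x : ell2) : ‖heat σ τ x‖ ≤ ‖x‖ := by
  exact (ell2.norm_diag_le _ 1 _ x).trans_eq (one_mul _)

variable {σ : ℕ → ℝ} {T : ℝ} {y y' f f' : ℝ → ell2}

theorem continuous_coord_comp (hf : Continuous f) (n : ℕ) : Continuous fun t => f t n :=
  (ell2.continuous_coord n).comp hf

theorem IsMild.sub (h : IsMild σ T y f) (h' : IsMild σ T y' f') :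
    IsMild σ T (fun t => y t - y' t) (fun t => f t - f' t) := fun t ht n => by
  have := (h t ht n).fun_sub (h' t ht n)
  refine this.congr_deriv ?_
  simp only [lp.coeFn_sub, Pi.sub_apply]
  ring

theorem IsMild.norm_sq_le (h : IsMild σ T y f) (hy : Continuous y) (hf : Continuous f) {s t : ℝ}
    (hs : 0 ≤ s) (hst : s ≤ t) (ht : t ≤ T) :
    ‖y t‖ ^ 2 ≤ ‖y s‖ ^ 2 + 1 / 2 * ∫ r in s..t, ‖f r‖ ^ 2 :=
  ell2.norm_sq_le_add_integral hf hst (by norm_num) fun n =>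
    sq_le_of_ode (σ := σ n) hst (continuous_coord_comp hy n) (continuous_coord_comp hf n)
      fun r hr => h r ⟨hs.trans_lt hr.1, hr.2.trans_le ht⟩ n

theorem IsMild.norm_sub_heat_sq_le (h : IsMild σ T y f) (hy : Continuous y) (hf : Continuous f)
    {s t : ℝ} (hs : 0 ≤ s) (hst : s ≤ t) (ht : t ≤ T) :
    ‖y t - heat σ (t - s) (y s)‖ ^ 2 ≤ 1 / 2 * ∫ r in s..t, ‖f r‖ ^ 2 := by
  have := ell2.norm_sq_le_add_integral (x := y t - heat σ (t - s) (y s)) (y := 0) hf hst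
    (K := 1 / 2) (by norm_num) fun n => by
      rw [lp.coeFn_sub, Pi.sub_apply, heat_apply σ (sub_nonneg.2 hst)]
      have := sub_exp_sq_le_of_ode (σ := σ n) hst (continuous_coord_comp hy n)
        (continuous_coord_comp hf n) fun r hr => h r ⟨hs.trans_lt hr.1, hr.2.trans_le ht⟩ n
      simpa using this
  simpa using this

/-- Each mode is solved explicitly. The scalar estimate bounds the tails of the solution by those of
the data, uniformly on bounded time intervals; this gives both membership in $\ell^2$ and continuity
in norm. -/
theorem exists_isMild (σ : ℕ → ℝ) (y₀ : ell2) (hf : Continuous f) :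
    ∃ y : ℝ → ell2, Continuous y ∧ y 0 = y₀ ∧ ∀ T, IsMild σ T y f := by
  let u : ℕ → ℝ → ℝ := fun n t => Real.exp (-(σ n ^ 2) * t) *
    (y₀ n + σ n * ∫ r in (0 : ℝ)..t, Real.exp (σ n ^ 2 * r) * f r n)
  have hu : ∀ n t, HasDerivAt (u n) (-(σ n ^ 2) * u n t + σ n * f t n) t := by
    intro n t
    have h1 : HasDerivAt (fun t => Real.exp (-(σ n ^ 2) * t))
        (Real.exp (-(σ n ^ 2) * t) * (-(σ n ^ 2) * 1)) t :=
      ((hasDerivAt_id t).const_mul _).exp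
    have hc : Continuous fun r => Real.exp (σ n ^ 2 * r) * f r n :=
      (by fun_prop : Continuous fun r => Real.exp (σ n ^ 2 * r)).mul (continuous_coord_comp hf n)
    have h2 := (((hc.integral_hasStrictDerivAt 0 t).hasDerivAt.const_mul (σ n)).const_add (y₀ n))
    refine (h1.fun_mul h2).congr_deriv ?_
    have h3 : Real.exp (-(σ n ^ 2) * t) * Real.exp (σ n ^ 2 * t) = 1 := by
      rw [← Real.exp_add]; simp
    simp only [u]
    linear_combination (σ n * f t n) * h3
  have huc : ∀ n, Continuous (u n) := fun n =>
    continuous_iff_continuousAt.2 fun t => (hu n t).continuousAt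
  have hu0 : ∀ n, u n 0 = y₀ n := fun n => by simp [u]
  have hb : ∀ n t, 0 ≤ t → u n t ^ 2 ≤ y₀ n ^ 2 + 1 / 2 * ∫ r in (0 : ℝ)..t, f r n ^ 2 := by
    intro n t ht
    have := sq_le_of_ode (σ := σ n) ht (huc n) (continuous_coord_comp hf n) fun r _ => hu n r
    rwa [hu0] at this
  have hsum : ∀ N M t, 0 ≤ t → ∑ n ∈ Finset.Ico N M, u n t ^ 2 ≤
      ell2.tailSq N y₀ + 1 / 2 * ∫ r in (0 : ℝ)..t, ell2.tailSq N (f r) := by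
    intro N M t ht
    have hi : ∀ n, IntervalIntegrable (fun r => f r n ^ 2) volume 0 t := fun n =>
      ((continuous_coord_comp hf n).pow 2).intervalIntegrable _ _
    calc _ ≤ ∑ n ∈ Finset.Ico N M, (y₀ n ^ 2 + 1 / 2 * ∫ r in (0 : ℝ)..t, f r n ^ 2) :=
          Finset.sum_le_sum fun n _ => hb n t ht
      _ = ∑ n ∈ Finset.Ico N M, y₀ n ^ 2 +
            1 / 2 * ∫ r in (0 : ℝ)..t, ∑ n ∈ Finset.Ico N M, f r n ^ 2 := by
          rw [Finset.sum_add_distrib, ← Finset.mul_sum,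
            intervalIntegral.integral_finsetSum fun n _ => hi n]
      _ ≤ _ := by
          refine add_le_add (ell2.sum_Ico_le_tailSq _ _ _)
            (mul_le_mul_of_nonneg_left ?_ (by norm_num))
          exact intervalIntegral.integral_mono_on ht
            ((continuous_finsetSum _ fun n _ =>
              (continuous_coord_comp hf n).pow 2).intervalIntegrable _ _)
            (((ell2.continuous_tailSq N).comp hf).intervalIntegrable _ _)
            fun r _ => ell2.sum_Ico_le_tailSq _ _ _
  have hmem : ∀ t, Memℓp (E := fun _ : ℕ => ℝ) (fun n => u n (max t 0)) 2 := fun t =>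
    ell2.memℓp_of_sum_le fun N => by
      have := hsum 0 N (max t 0) (le_max_right _ _)
      rwa [← Finset.range_eq_Ico] at this
  -- Freezing at 0 is needed: backwards in time the modes may grow and leave $\ell^2$.
  let y : ℝ → ell2 := fun t => ⟨fun n => u n (max t 0), hmem t⟩
  have hyn : ∀ t n, y t n = u n (max t 0) := fun _ _ => rfl
  have hcont : ∀ T, 0 ≤ T → ContinuousOn y (Iic T) := by
    intro T hT
    refine ell2.continuousOn_of_uniform_tails
      (fun n => ((huc n).comp (continuous_id.max continuous_const)).continuousOn) fun ε hε => ?_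
    have h1 := (ell2.tendsto_tailSq y₀).add
      ((ell2.tendsto_integral_tailSq hf 0 T).const_mul (1 / 2))
    rw [mul_zero, add_zero] at h1
    obtain ⟨N, hN⟩ := (h1.eventually (gt_mem_nhds hε)).exists
    refine ⟨N, fun t ht M => (hsum N M (max t 0) (le_max_right _ _)).trans ?_⟩
    have h2 : ∫ r in (0 : ℝ)..max t 0, ell2.tailSq N (f r) ≤
        ∫ r in (0 : ℝ)..T, ell2.tailSq N (f r) :=
      intervalIntegral.integral_mono_interval le_rfl (le_max_right _ _) (max_le ht hT)
        (ae_of_all _ fun r => ell2.tailSq_nonneg _ _)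
        (((ell2.continuous_tailSq N).comp hf).intervalIntegrable _ _)
    linarith
  refine ⟨y, continuous_iff_continuousAt.2 fun t => ?_, ?_, fun T t ht n => ?_⟩
  · exact (hcont (|t| + 1) (by positivity)).continuousAt
      (Iic_mem_nhds ((le_abs_self t).trans_lt (lt_add_one _)))
  · ext n
    simp [hyn, hu0]
  · have h1 : (fun s => y s n) =ᶠ[𝓝 t] u n := by
      filter_upwards [Ioi_mem_nhds ht.1] with s hs
      rw [hyn, max_eq_left (le_of_lt hs)]
    rw [hyn, max_eq_left ht.1.le]
    exact (hu n t).congr_of_eventuallyEq h1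

/-! ### Semilinear equations: uniqueness, and existence for globally Lipschitz nonlinearities -/

/-- The difference starts at 0, so $\|y-y'\|^2(t)\le\frac12L^2\int_0^t\|y-y'\|^2$; Gronwall with
zero constant applies. -/
theorem IsMild.eq_of_lipschitzOn {L : ℝ}
    (hy : Continuous y) (hy' : Continuous y') (hf : Continuous f) (hf' : Continuous f')
    (h : IsMild σ T y f) (h' : IsMild σ T y' f') (h0 : y 0 = y' 0)
    (hL : ∀ t ∈ Icc 0 T, ‖f t - f' t‖ ≤ L * ‖y t - y' t‖) :
    ∀ t ∈ Icc 0 T, y t = y' t := by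
  have key := gronwall_integral (u := fun t => ‖y t - y' t‖ ^ 2) (k := fun _ => 1 / 2 * L ^ 2)
    (c := 0) (T := T) (by fun_prop) (by fun_prop) (fun _ => by positivity) fun t ht => by
      have h1 := (h.sub h').norm_sq_le (by fun_prop) (by fun_prop) le_rfl ht.1 ht.2
      rw [h0, sub_self, norm_zero, zero_pow two_ne_zero,
        ← intervalIntegral.integral_const_mul] at h1
      refine h1.trans (add_le_add_right (intervalIntegral.integral_mono_on ht.1
        (Continuous.intervalIntegrable (by fun_prop) _ _)
        (Continuous.intervalIntegrable (by fun_prop) _ _) fun r hr => ?_) _)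
      rw [mul_assoc, ← mul_pow]
      gcongr
      exact hL r ⟨hr.1, hr.2.trans ht.2⟩
  intro t ht
  have := key t ht
  rw [zero_mul] at this
  have h2 : ‖y t - y' t‖ = 0 := by
    have := this.antisymm (sq_nonneg _)
    simpa using this
  exact sub_eq_zero.1 (norm_eq_zero.1 h2)

/-- Picard iteration on $C([0,T],\ell^2)$: iterating the energy inequality bounds the square of the
Lipschitz constant of the $m$-th iterate by $(\frac12L^2T)^m/m!$, so some iterate is a contraction
without any smallness of $T$. -/
theorem exists_isMild_of_lipschitz (σ : ℕ → ℝ) (y₀ : ell2) {G : ell2 → ell2} {L : ℝ}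
    (hL0 : 0 ≤ L) (hG : ∀ x x', ‖G x - G x'‖ ≤ L * ‖x - x'‖) (hT : 0 ≤ T) :
    ∃ y : ℝ → ell2, Continuous y ∧ y 0 = y₀ ∧ IsMild σ T y fun t => G (y t) := by
  have hGc : Continuous G := by
    refine (LipschitzWith.of_dist_le_mul (K := ⟨L, hL0⟩) fun x x' => ?_).continuous
    rw [dist_eq_norm, dist_eq_norm]
    exact hG x x'
  let ext : C(Icc 0 T, ell2) → ℝ → ell2 := fun u => IccExtend hT u
  have hext : ∀ u, Continuous (ext u) := fun u => u.continuous.Icc_extend'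
  choose Y hYc hY0 hYm using fun u : C(Icc 0 T, ell2) =>
    exists_isMild σ y₀ (hGc.comp (hext u))
  let Φ : C(Icc 0 T, ell2) → C(Icc 0 T, ell2) := fun u =>
    ⟨fun t => Y u t, (hYc u).comp continuous_subtype_val⟩
  have hextΦ : ∀ u, ∀ t ∈ Icc 0 T, ext (Φ u) t = Y u t := fun u t ht => by
    simp only [ext, IccExtend_of_mem hT _ ht]
    rfl
  have hiter : ∀ u v : C(Icc 0 T, ell2), ∀ m : ℕ, ∀ t ∈ Icc 0 T,
      ‖ext (Φ^[m] u) t - ext (Φ^[m] v) t‖ ^ 2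
        ≤ dist u v ^ 2 * ((1 / 2 * L ^ 2 * t) ^ m / m.factorial) := by
    intro u v m
    induction m with
    | zero =>
      intro t ht
      simp only [Function.iterate_zero, id_eq, pow_zero, Nat.factorial_zero, Nat.cast_one, div_one,
        mul_one, ext, IccExtend_of_mem hT _ ht]
      rw [← dist_eq_norm]
      gcongr
      exact ContinuousMap.dist_apply_le_dist _
    | succ m ih =>
      intro t ht
      rw [Function.iterate_succ_apply', Function.iterate_succ_apply', hextΦ _ t ht, hextΦ _ t ht]
      set p := Φ^[m] u
      set q := Φ^[m] v
      have hc : Continuous fun r => G (ext p r) - G (ext q r) :=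
        (hGc.comp (hext p)).sub (hGc.comp (hext q))
      have h1 := ((hYm p T).sub (hYm q T)).norm_sq_le ((hYc p).sub (hYc q)) hc le_rfl ht.1 ht.2
      rw [hY0, hY0, sub_self, norm_zero, zero_pow two_ne_zero, zero_add] at h1
      refine h1.trans ?_
      have h2 : ∫ r in (0 : ℝ)..t, ‖G (ext p r) - G (ext q r)‖ ^ 2 ≤
          ∫ r in (0 : ℝ)..t, L ^ 2 * dist u v ^ 2 * (1 / 2 * L ^ 2) ^ m / m.factorial * r ^ m := by
        refine intervalIntegral.integral_mono_on ht.1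
          ((hc.norm.pow 2).intervalIntegrable _ _)
          (Continuous.intervalIntegrable (by fun_prop) _ _) fun r hr => ?_
        have h3 := ih r ⟨hr.1, hr.2.trans ht.2⟩
        calc _ ≤ (L * ‖ext p r - ext q r‖) ^ 2 := by gcongr; exact hG _ _
          _ = L ^ 2 * ‖ext p r - ext q r‖ ^ 2 := mul_pow _ _ _
          _ ≤ L ^ 2 * (dist u v ^ 2 * ((1 / 2 * L ^ 2 * r) ^ m / m.factorial)) := by gcongr
          _ = _ := by rw [mul_pow _ r]; ring
      rw [intervalIntegral.integral_const_mul, integral_pow] at h2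
      simp only [Function.comp_apply]
      refine (mul_le_mul_of_nonneg_left h2 (by norm_num)).trans (le_of_eq ?_)
      rw [Nat.factorial_succ]
      push_cast
      have : (m.factorial : ℝ) ≠ 0 := by positivity
      have : (m : ℝ) + 1 ≠ 0 := by positivity
      field_simp
      ring
  -- `hiter` estimates squared distances, hence the threshold $(1/2)^2$ for the contraction constant
  -- $1/2$.
  obtain ⟨m, hm⟩ : ∃ m : ℕ, (1 / 2 * L ^ 2 * T) ^ m / m.factorial < (1 / 2) ^ 2 :=
    ((FloorSemiring.tendsto_pow_div_factorial_atTop (1 / 2 * L ^ 2 * T)).eventually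
      (gt_mem_nhds (by norm_num))).exists
  have hcontr : ContractingWith (1 / 2 : NNReal) Φ^[m] := by
    refine ⟨by rw [← NNReal.coe_lt_coe]; norm_num, LipschitzWith.of_dist_le_mul fun u v => ?_⟩
    rw [ContinuousMap.dist_le (by positivity)]
    rintro ⟨t, ht⟩
    have h1 := hiter u v m t ht
    simp only [ext, IccExtend_of_mem hT _ ht] at h1
    rw [dist_eq_norm]
    have h2 : (1 / 2 * L ^ 2 * t) ^ m / m.factorial ≤ (1 / 2) ^ 2 := by
      refine le_trans ?_ hm.le
      have := ht.1
      have := ht.2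
      gcongr
    have h3 : dist u v ^ 2 * ((1 / 2 * L ^ 2 * t) ^ m / m.factorial) ≤
        (((1 / 2 : NNReal) : ℝ) * dist u v) ^ 2 := by
      refine (mul_le_mul_of_nonneg_left h2 (sq_nonneg _)).trans_eq ?_
      push_cast
      ring
    exact (abs_le_of_sq_le_sq' (h1.trans h3) (by positivity)).2
  -- The unique fixed point of an iterate is fixed by `Φ` itself.
  have hfix := hcontr.isFixedPt_fixedPoint_iterate
  set w := ContractingWith.fixedPoint Φ^[m] hcontr
  refine ⟨Y w, hYc w, hY0 w, fun t ht n => ?_⟩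
  have h1 : ext w t = Y w t := by
    have := hextΦ w t (Ioo_subset_Icc_self ht)
    rwa [hfix] at this
  have := hYm w T t ht n
  simpa only [Function.comp_apply, h1] using this

end LinearEvolution

section Semilinear

/-! ### Global solutions for quadratic nonlinearities that conserve the energy -/

/-! ### Radial truncation of a quadratic map. -/

section Truncation

variable {E : Type*} [NormedAddCommGroup E] [NormedSpace ℝ E]

/-- The radial retraction onto the ball of radius `R`. -/
noncomputable def radial (R : ℝ) (x : E) : E := (R / max R ‖x‖) • x

theorem radial_of_norm_le {R : ℝ} (hR : 0 < R) {x : E} (hx : ‖x‖ ≤ R) : radial R x = x := by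
  rw [radial, max_eq_left hx, div_self hR.ne', one_smul]

theorem div_max_mem_Icc {R : ℝ} (hR : 0 < R) (r : ℝ) : R / max R r ∈ Icc (0 : ℝ) 1 :=
  ⟨by positivity, div_le_one_of_le₀ (le_max_left _ _) (by positivity)⟩

theorem norm_radial_le_norm {R : ℝ} (hR : 0 < R) (x : E) : ‖radial R x‖ ≤ ‖x‖ := by
  rw [radial, norm_smul, Real.norm_of_nonneg (div_max_mem_Icc hR ‖x‖).1]
  exact mul_le_of_le_one_left (norm_nonneg _) (div_max_mem_Icc hR ‖x‖).2

theorem norm_radial_le {R : ℝ} (hR : 0 < R) (x : E) : ‖radial R x‖ ≤ R := by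
  rw [radial, norm_smul, Real.norm_of_nonneg (div_max_mem_Icc hR ‖x‖).1, div_mul_eq_mul_div,
    div_le_iff₀ (by positivity)]
  exact mul_le_mul_of_nonneg_left (le_max_right _ _) hR.le

/-- Changing the vector and changing the scaling factor each cost at most $\|x-x'\|$. -/
theorem norm_radial_sub_le {R : ℝ} (hR : 0 < R) (x x' : E) :
    ‖radial R x - radial R x'‖ ≤ 2 * ‖x - x'‖ := by
  set m := max R ‖x‖
  set m' := max R ‖x'‖
  have hm : 0 < m := hR.trans_le (le_max_left _ _)
  have hm' : 0 < m' := hR.trans_le (le_max_left _ _)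
  have h1 : radial R x - radial R x' = (R / m) • (x - x') + (R / m - R / m') • x' := by
    rw [radial, radial, smul_sub, sub_smul]; abel
  have h2 : |R / m - R / m'| * ‖x'‖ ≤ ‖x - x'‖ := by
    have h3 : R / m - R / m' = (R / m) * ((m' - m) / m') := by field_simp
    have h4 : |m' - m| ≤ ‖x - x'‖ := by
      simp only [m, m']
      rw [max_comm R, max_comm R]
      refine (abs_max_sub_max_le_abs _ _ _).trans ?_
      rw [abs_sub_comm]
      exact abs_norm_sub_norm_le x x'
    rw [h3, abs_mul, abs_of_nonneg (div_max_mem_Icc hR ‖x‖).1, abs_div, abs_of_pos hm']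
    calc _ = R / m * (|m' - m| * (‖x'‖ / m')) := by ring
      _ ≤ 1 * (‖x - x'‖ * 1) := by
          gcongr
          · exact (div_max_mem_Icc hR ‖x‖).2
          · exact div_le_one_of_le₀ (le_max_right _ _) hm'.le
      _ = _ := by ring
  rw [h1]
  refine (norm_add_le _ _).trans ?_
  rw [norm_smul, norm_smul, Real.norm_of_nonneg (div_max_mem_Icc hR ‖x‖).1, Real.norm_eq_abs]
  have := mul_le_of_le_one_left (norm_nonneg (x - x')) (div_max_mem_Icc hR ‖x‖).2
  linarith

theorem norm_bilin_sub_le (B : E →L[ℝ] E →L[ℝ] E) {R : ℝ} {x x' : E} (hx : ‖x‖ ≤ R)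
    (hx' : ‖x'‖ ≤ R) : ‖B x x - B x' x'‖ ≤ ‖B‖ * (2 * R) * ‖x - x'‖ := by
  have h1 : B x x - B x' x' = B x (x - x') + B (x - x') x' := by
    simp
  rw [h1]
  refine (norm_add_le _ _).trans ?_
  calc _ ≤ ‖B‖ * ‖x‖ * ‖x - x'‖ + ‖B‖ * ‖x - x'‖ * ‖x'‖ :=
        add_le_add (B.le_opNorm₂ _ _) (B.le_opNorm₂ _ _)
    _ ≤ ‖B‖ * R * ‖x - x'‖ + ‖B‖ * ‖x - x'‖ * R := by gcongr
    _ = _ := by ring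

end Truncation

/-! ### Energy identity, a priori bound and global existence in coordinates. -/

variable {σ : ℕ → ℝ} {T a : ℝ} {y f : ℝ → ell2} {i : ell2 →L[ℝ] ell2}
  {B : ell2 →L[ℝ] ell2 →L[ℝ] ell2}

theorem hasDerivAt_inclusion_coord (hi : ∀ y n, y n = σ n * i y n) (hσ : ∀ n, σ n ≠ 0)
    (h : IsMild σ T y f) {t : ℝ} (ht : t ∈ Ioo 0 T) (n : ℕ) :
    HasDerivAt (fun s => i (y s) n) (f t n - σ n * y t n) t := by
  have h1 := (h t ht n).const_mul (σ n)⁻¹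
  have h2 : (fun s => (σ n)⁻¹ * y s n) = fun s => i (y s) n := by
    funext s
    rw [hi (y s) n, inv_mul_cancel_left₀ (hσ n)]
  rw [h2] at h1
  refine h1.congr_deriv ?_
  field_simp [hσ n]
  ring

/-- With $z=iy$, each mode satisfies $(z_n^2)'=2z_nf_n-2y_n^2$, because $\sigma_nz_n=y_n$. Dominated
convergence sums the integrated identities, so no derivative of $z$ in norm is needed. -/
theorem IsMild.energy_eq (hi : ∀ y n, y n = σ n * i y n) (hσ : ∀ n, σ n ≠ 0)
    (h : IsMild σ T y f) (hy : Continuous y) (hf : Continuous f) {t : ℝ} (ht : t ∈ Icc 0 T) :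
    ‖i (y t)‖ ^ 2 - ‖i (y 0)‖ ^ 2 =
      ∫ r in (0 : ℝ)..t, (2 * inner ℝ (i (y r)) (f r) - 2 * ‖y r‖ ^ 2) := by
  have hz : Continuous fun r => i (y r) := i.continuous.comp hy
  have hcoord : ∀ n, Continuous fun r => 2 * (i (y r) n * f r n) - 2 * y r n ^ 2 := fun n =>
    (((continuous_coord_comp hz n).mul (continuous_coord_comp hf n)).const_mul 2).sub
      (((continuous_coord_comp hy n).pow 2).const_mul 2)
  have h1 : ∀ N, ∑ n ∈ Finset.range N, i (y t) n ^ 2 - ∑ n ∈ Finset.range N, i (y 0) n ^ 2 =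
      ∫ r in (0 : ℝ)..t, ∑ n ∈ Finset.range N, (2 * (i (y r) n * f r n) - 2 * y r n ^ 2) := by
    intro N
    rw [intervalIntegral.integral_finsetSum fun n _ => (hcoord n).intervalIntegrable _ _,
      ← Finset.sum_sub_distrib]
    refine Finset.sum_congr rfl fun n _ => ?_
    refine sub_eq_integral_of_ode (u := fun r => i (y r) n ^ 2) ht.1
      ((continuous_coord_comp hz n).pow 2).continuousOn (hcoord n) fun r hr => ?_
    refine ((hasDerivAt_inclusion_coord hi hσ h ⟨hr.1, hr.2.trans_le ht.2⟩ n).fun_pow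
      2).congr_deriv ?_
    rw [hi (y r) n]
    push_cast
    ring
  have h2 := (i (y t)).hasSum_sq.tendsto_sum_nat.sub (i (y 0)).hasSum_sq.tendsto_sum_nat
  refine tendsto_nhds_unique h2 ?_
  simp_rw [h1]
  refine intervalIntegral.tendsto_integral_filter_of_dominated_convergence
    (fun r => ‖i (y r)‖ ^ 2 + ‖f r‖ ^ 2 + 2 * ‖y r‖ ^ 2)
    (Eventually.of_forall fun N =>
      (continuous_finsetSum _ fun n _ => hcoord n).aestronglyMeasurable)
    (Eventually.of_forall fun N => ae_of_all _ fun r _ => ?_)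
    (Continuous.intervalIntegrable (by fun_prop) _ _) (ae_of_all _ fun r _ => ?_)
  · refine (norm_sum_le _ _).trans ?_
    calc _ ≤ ∑ n ∈ Finset.range N, (i (y r) n ^ 2 + f r n ^ 2 + 2 * y r n ^ 2) := by
          refine Finset.sum_le_sum fun n _ => ?_
          rw [Real.norm_eq_abs, abs_le]
          constructor <;> nlinarith [sq_nonneg (i (y r) n + f r n), sq_nonneg (i (y r) n - f r n),
            sq_nonneg (y r n)]
      _ ≤ _ := by
          rw [Finset.sum_add_distrib, Finset.sum_add_distrib, ← Finset.mul_sum]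
          exact add_le_add (add_le_add (ell2.sum_sq_le _ _) (ell2.sum_sq_le _ _))
            (mul_le_mul_of_nonneg_left (ell2.sum_sq_le _ _) two_pos.le)
  · have h3 := (lp.hasSum_inner (𝕜 := ℝ) (i (y r)) (f r)).mul_left 2
    have h4 := (h3.sub ((y r).hasSum_sq.mul_left 2)).tendsto_sum_nat
    simpa [mul_comm] using h4

/-- Quadratic growth alone would allow blow-up; the energy identity supplies a bound on
$\int\|y\|^2$, and $\frac12\|f\|^2\le(b^2\|y\|^2+a^2\|i\|^2)\|y\|^2$ is then a linear Gronwall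
estimate with integrable kernel. `K` is chosen before `y` and `f`, so it serves every truncation
radius at once. -/
theorem exists_apriori_bound (σ : ℕ → ℝ) (hi : ∀ y n, y n = σ n * i y n) (hσ : ∀ n, σ n ≠ 0)
    (a b T : ℝ) (y₀ : ell2) : ∃ K, ∀ y f : ℝ → ell2, Continuous y → Continuous f → y 0 = y₀ →
      IsMild σ T y f → (∀ t, inner ℝ (i (y t)) (f t) = a * ‖i (y t)‖ ^ 2) →
      (∀ t, ‖f t‖ ≤ b * ‖y t‖ ^ 2 + |a| * ‖i (y t)‖) → ∀ t ∈ Icc 0 T, ‖y t‖ ≤ K := by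
  -- `Z` bounds $\|z\|^2$ by Gronwall; `D` bounds $\int\|y\|^2$ through the dissipation term
  -- $2\int\|y\|^2$ of the energy identity.
  set Z := ‖i y₀‖ ^ 2 * Real.exp (2 * |a| * T)
  set D := 1 / 2 * (‖i y₀‖ ^ 2 + 2 * |a| * (T * Z))
  refine ⟨√(‖y₀‖ ^ 2 * Real.exp (b ^ 2 * D + a ^ 2 * ‖i‖ ^ 2 * T)),
    fun y f hy hf hy0 h horth hgrowth t ht => ?_⟩
  have hz : Continuous fun r => i (y r) := i.continuous.comp hy
  have hen : ∀ t ∈ Icc 0 T, ‖i (y t)‖ ^ 2 + 2 * ∫ r in (0 : ℝ)..t, ‖y r‖ ^ 2 ≤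
      ‖i y₀‖ ^ 2 + ∫ r in (0 : ℝ)..t, 2 * |a| * ‖i (y r)‖ ^ 2 := by
    intro t ht
    have h1 := h.energy_eq hi hσ hy hf ht
    rw [intervalIntegral.integral_sub (Continuous.intervalIntegrable (by fun_prop) _ _)
      (Continuous.intervalIntegrable (by fun_prop) _ _),
      intervalIntegral.integral_const_mul 2 fun r => ‖y r‖ ^ 2, hy0] at h1
    have h2 : ∫ r in (0 : ℝ)..t, 2 * inner ℝ (i (y r)) (f r) ≤
        ∫ r in (0 : ℝ)..t, 2 * |a| * ‖i (y r)‖ ^ 2 := by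
      refine intervalIntegral.integral_mono_on ht.1
        (Continuous.intervalIntegrable (by fun_prop) _ _)
        (Continuous.intervalIntegrable (by fun_prop) _ _) fun r _ => ?_
      rw [horth]
      have := mul_le_mul_of_nonneg_right (le_abs_self a) (sq_nonneg ‖i (y r)‖)
      linarith
    linarith
  have hZ : ∀ t ∈ Icc 0 T, ‖i (y t)‖ ^ 2 ≤ Z := by
    intro t ht
    have h1 := gronwall_integral (u := fun t => ‖i (y t)‖ ^ 2) (k := fun _ => 2 * |a|) (T := T)
      (c := ‖i y₀‖ ^ 2) (by fun_prop) continuous_const (fun _ => by positivity) (fun t ht => by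
        have h2 := hen t ht
        have h3 : 0 ≤ ∫ r in (0 : ℝ)..t, ‖y r‖ ^ 2 :=
          intervalIntegral.integral_nonneg ht.1 fun r _ => by positivity
        linarith) t ht
    refine h1.trans ?_
    simp only [intervalIntegral.integral_const, sub_zero, smul_eq_mul]
    rw [mul_comm t]
    simp only [Z]
    gcongr
    exact ht.2
  have hD : ∀ t ∈ Icc 0 T, ∫ r in (0 : ℝ)..t, ‖y r‖ ^ 2 ≤ D := by
    intro t ht
    have h1 := hen t ht
    have h2 : ∫ r in (0 : ℝ)..t, 2 * |a| * ‖i (y r)‖ ^ 2 ≤ ∫ r in (0 : ℝ)..t, 2 * |a| * Z := by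
      refine intervalIntegral.integral_mono_on ht.1
        (Continuous.intervalIntegrable (by fun_prop) _ _)
        (Continuous.intervalIntegrable (by fun_prop) _ _) fun r hr => ?_
      gcongr
      exact hZ r ⟨hr.1, hr.2.trans ht.2⟩
    have h3 : t * (2 * |a| * Z) ≤ 2 * |a| * (T * Z) := by
      rw [mul_left_comm]
      have := ht.2
      gcongr
    simp only [intervalIntegral.integral_const, sub_zero, smul_eq_mul] at h2
    have h4 : 0 ≤ ‖i (y t)‖ ^ 2 := by positivity
    simp only [D]
    linarith
  refine Real.le_sqrt_of_sq_le ?_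
  have h1 := gronwall_integral (u := fun t => ‖y t‖ ^ 2)
    (k := fun t => b ^ 2 * ‖y t‖ ^ 2 + a ^ 2 * ‖i‖ ^ 2) (T := T)
    (c := ‖y₀‖ ^ 2) (by fun_prop) (by fun_prop) (fun _ => by positivity) (fun t ht => by
      have h2 := h.norm_sq_le hy hf le_rfl ht.1 ht.2
      rw [hy0, ← intervalIntegral.integral_const_mul] at h2
      refine h2.trans (add_le_add_right (intervalIntegral.integral_mono_on ht.1
        (Continuous.intervalIntegrable (by fun_prop) _ _)
        (Continuous.intervalIntegrable (by fun_prop) _ _) fun r hr => ?_) _)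
      have h3 : ‖f r‖ ^ 2 ≤ (b * ‖y r‖ ^ 2 + |a| * (‖i‖ * ‖y r‖)) ^ 2 := by
        gcongr
        exact (hgrowth r).trans (by gcongr; exact i.le_opNorm _)
      have h4 : (|a| * (‖i‖ * ‖y r‖)) ^ 2 = a ^ 2 * ‖i‖ ^ 2 * ‖y r‖ ^ 2 := by
        rw [mul_pow, sq_abs]; ring
      nlinarith [sq_nonneg (b * ‖y r‖ ^ 2 - |a| * (‖i‖ * ‖y r‖))]) t ht
  refine h1.trans ?_
  gcongr
  rw [intervalIntegral.integral_add (Continuous.intervalIntegrable (by fun_prop) _ _)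
      (Continuous.intervalIntegrable (by fun_prop) _ _), intervalIntegral.integral_const_mul]
  simp only [intervalIntegral.integral_const, sub_zero, smul_eq_mul]
  have h5 := hD t ht
  rw [mul_comm t]
  gcongr
  exact ht.2

theorem continuous_quadratic (B : ell2 →L[ℝ] ell2 →L[ℝ] ell2) (a : ℝ) (i : ell2 →L[ℝ] ell2) :
    Continuous fun x => B x x + a • i x := by
  fun_prop

theorem norm_quadratic_sub_le {R : ℝ} {x x' : ell2} (hx : ‖x‖ ≤ R) (hx' : ‖x'‖ ≤ R) :
    ‖(B x x + a • i x) - (B x' x' + a • i x')‖ ≤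
      (‖B‖ * (2 * R) + |a| * ‖i‖) * ‖x - x'‖ := by
  have h1 : (B x x + a • i x) - (B x' x' + a • i x') = (B x x - B x' x') + a • i (x - x') := by
    rw [map_sub, smul_sub]; abel
  rw [h1]
  refine (norm_add_le _ _).trans ?_
  rw [add_mul, norm_smul, Real.norm_eq_abs, mul_assoc |a|]
  exact add_le_add (norm_bilin_sub_le B hx hx')
    (mul_le_mul_of_nonneg_left (i.le_opNorm _) (abs_nonneg _))

theorem exists_norm_le_on_Icc (hy : Continuous y) (T : ℝ) : ∃ R, ∀ t ∈ Icc 0 T, ‖y t‖ ≤ R :=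
  isCompact_Icc.exists_bound_of_continuousOn hy.continuousOn

theorem IsMild.unique {y' : ℝ → ell2} (hy : Continuous y) (hy' : Continuous y')
    (h : IsMild σ T y fun t => B (y t) (y t) + a • i (y t))
    (h' : IsMild σ T y' fun t => B (y' t) (y' t) + a • i (y' t)) (h0 : y 0 = y' 0) :
    ∀ t ∈ Icc 0 T, y t = y' t := by
  obtain ⟨R, hR⟩ := exists_norm_le_on_Icc hy T
  obtain ⟨R', hR'⟩ := exists_norm_le_on_Icc hy' T
  exact h.eq_of_lipschitzOn hy hy' ((continuous_quadratic B a i).comp hy)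
    ((continuous_quadratic B a i).comp hy') h' h0 fun t ht =>
      norm_quadratic_sub_le ((hR t ht).trans (le_max_left R R'))
        ((hR' t ht).trans (le_max_right R R'))

/-- Radial truncation only multiplies $B(x,x)$ by a scalar in $[0,1]$, so orthogonality and growth
survive with the same constants. The a priori bound therefore holds for the truncated equation, and
a radius above it makes the truncation inactive. -/
theorem exists_isMild_quadratic_on (hi : ∀ y n, y n = σ n * i y n) (hσ : ∀ n, σ n ≠ 0)
    (hB : ∀ x, inner ℝ (i x) (B x x) = 0) (hT : 0 ≤ T) (y₀ : ell2) :
    ∃ y : ℝ → ell2, Continuous y ∧ y 0 = y₀ ∧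
      IsMild σ T y fun t => B (y t) (y t) + a • i (y t) := by
  obtain ⟨K, hK⟩ := exists_apriori_bound σ hi hσ a ‖B‖ T y₀
  set R := |K| + 1
  have hR : 0 < R := by positivity
  set G : ell2 → ell2 := fun x => B (radial R x) (radial R x) + a • i x
  have hG : ∀ x x', ‖G x - G x'‖ ≤ (‖B‖ * (2 * R) * 2 + |a| * ‖i‖) * ‖x - x'‖ := by
    intro x x'
    have h1 : G x - G x' = (B (radial R x) (radial R x) - B (radial R x') (radial R x')) +
        a • i (x - x') := by
      simp only [G]
      rw [map_sub, smul_sub]; abel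
    rw [h1]
    refine (norm_add_le _ _).trans ?_
    rw [add_mul, norm_smul, Real.norm_eq_abs, mul_assoc |a|]
    refine add_le_add ((norm_bilin_sub_le B (norm_radial_le hR x) (norm_radial_le hR x')).trans ?_)
      (mul_le_mul_of_nonneg_left (i.le_opNorm _) (abs_nonneg _))
    rw [mul_assoc _ 2]
    gcongr
    exact norm_radial_sub_le hR x x'
  have hGc : Continuous G := by
    refine (LipschitzWith.of_dist_le_mul
      (K := ⟨‖B‖ * (2 * R) * 2 + |a| * ‖i‖, by positivity⟩) fun x x' => ?_).continuous
    rw [dist_eq_norm, dist_eq_norm]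
    exact hG x x'
  obtain ⟨y, hy, hy0, h⟩ := exists_isMild_of_lipschitz σ y₀ (by positivity) hG hT
  have hbd := hK y _ hy (hGc.comp hy) hy0 h (fun t => by
    simp only [G, Function.comp_apply, inner_add_right, inner_smul_right,
      real_inner_self_eq_norm_sq, add_eq_right]
    simp only [radial, map_smul, smul_apply, inner_smul_right, hB, mul_zero])
    (fun t => by
      refine (norm_add_le _ _).trans ?_
      rw [norm_smul, Real.norm_eq_abs]
      refine add_le_add_left ((B.le_opNorm₂ _ _).trans ?_) _
      rw [mul_assoc, ← sq]
      gcongr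
      exact norm_radial_le_norm hR _)
  refine ⟨y, hy, hy0, fun t ht n => ?_⟩
  have := h t ht n
  simp only [G] at this
  rwa [radial_of_norm_le hR
    ((hbd t (Ioo_subset_Icc_self ht)).trans ((le_abs_self K).trans (by simp [R])))] at this

theorem exists_isMild_quadratic (hi : ∀ y n, y n = σ n * i y n) (hσ : ∀ n, σ n ≠ 0)
    (hB : ∀ x, inner ℝ (i x) (B x x) = 0) (y₀ : ell2) :
    ∃ y : ℝ → ell2, Continuous y ∧ y 0 = y₀ ∧
      ∀ T, IsMild σ T y fun t => B (y t) (y t) + a • i (y t) := by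
  choose Y hY hY0 hYm using fun m : ℕ =>
    exists_isMild_quadratic_on (a := a) hi hσ hB m.cast_nonneg y₀
  have huniq : ∀ (m k : ℕ) (t : ℝ), 0 ≤ t → t ≤ m → t ≤ k → Y m t = Y k t := by
    intro m k t ht0 htm htk
    refine IsMild.unique (T := t) (hY m) (hY k) (fun r hr => hYm m r ⟨hr.1, hr.2.trans_le htm⟩)
      (fun r hr => hYm k r ⟨hr.1, hr.2.trans_le htk⟩) (by rw [hY0, hY0]) t ⟨ht0, le_rfl⟩
  -- The solutions on the intervals $[0,m]$ agree where they overlap, so any integer above `t` may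
  -- be used.
  let y : ℝ → ell2 := fun t => Y ⌈t⌉₊ (max t 0)
  have hyY : ∀ (m : ℕ) (t : ℝ), t ≤ m → y t = Y m (max t 0) := fun m t ht =>
    huniq _ _ _ (le_max_right _ _) (max_le (Nat.le_ceil t) (Nat.cast_nonneg _))
      (max_le ht (Nat.cast_nonneg _))
  have hev : ∀ t : ℝ, ∃ m : ℕ, t < m ∧ y =ᶠ[𝓝 t] fun s => Y m (max s 0) := fun t => by
    obtain ⟨m, hm⟩ := exists_nat_gt t
    refine ⟨m, hm, ?_⟩
    filter_upwards [Iio_mem_nhds hm] with s hs using hyY m s (le_of_lt hs)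
  refine ⟨y, continuous_iff_continuousAt.2 fun t => ?_, ?_, fun T t ht n => ?_⟩
  · obtain ⟨m, -, hm⟩ := hev t
    exact (((hY m).comp (continuous_id.max continuous_const)).continuousAt).congr hm.symm
  · rw [hyY 0 0 (by simp), max_self, hY0]
  · obtain ⟨m, htm, hm⟩ := hev t
    have h1 : (fun s => y s n) =ᶠ[𝓝 t] fun s => Y m s n := by
      filter_upwards [hm, Ioi_mem_nhds ht.1] with s hs hs'
      rw [hs, max_eq_left (le_of_lt hs')]
    have h2 : y t = Y m t := by rw [hm.eq_of_nhds, max_eq_left ht.1.le]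
    simp only [h2]
    exact (hYm m t ⟨ht.1, htm⟩ n).congr_of_eventuallyEq h1

end Semilinear

section Regularity

/-! ### Regularity and compactness of mild solutions -/

theorem ell2.norm_le_of_coord_le {x y : ell2} {C : ℝ} (hC : 0 ≤ C) (h : ∀ n, |x n| ≤ C * |y n|) :
    ‖x‖ ≤ C * ‖y‖ := by
  refine (abs_le_of_sq_le_sq' (norm_sq_le_of_sum_le (C := (C * ‖y‖) ^ 2) fun N => ?_)
    (by positivity)).2
  calc _ ≤ ∑ n ∈ Finset.range N, C ^ 2 * y n ^ 2 := Finset.sum_le_sum fun n _ => by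
        rw [← sq_abs (x n), ← sq_abs (y n), ← mul_pow]
        gcongr
        exact h n
    _ ≤ _ := by
        rw [← Finset.mul_sum, mul_pow]
        gcongr
        exact y.sum_sq_le _

theorem mul_exp_neg_le_one (x : ℝ) : x * Real.exp (-x) ≤ 1 := by
  rw [Real.exp_neg, ← div_eq_mul_inv, div_le_one (Real.exp_pos x)]
  linarith [Real.add_one_le_exp x]

theorem mul_exp_neg_mul_le {ρ : ℝ} (hρ : 0 < ρ) (μ : ℝ) : μ * Real.exp (-μ * ρ) ≤ 1 / ρ := by
  rw [le_div_iff₀ hρ]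
  have := mul_exp_neg_le_one (μ * ρ)
  rw [← neg_mul] at this
  linarith

/-- In each mode $(1-e^{-\mu h})e^{-\mu\eta}\le h\,\mu e^{-\mu\eta}\le h/\eta$, uniformly in $\mu$.
-/
theorem norm_heat_add_sub_heat_le (σ : ℕ → ℝ) {h η : ℝ} (hh : 0 ≤ h) (hη : 0 < η) (x : ell2) :
    ‖heat σ (h + η) x - heat σ η x‖ ≤ h / η * ‖x‖ := by
  refine ell2.norm_le_of_coord_le (by positivity) fun n => ?_
  rw [lp.coeFn_sub, Pi.sub_apply, heat_apply σ (by positivity), heat_apply σ hη.le, ← sub_mul,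
    abs_mul]
  gcongr
  set μ := σ n ^ 2
  have hμ : 0 ≤ μ := sq_nonneg _
  have h1 : Real.exp (-μ * (h + η)) = Real.exp (-μ * h) * Real.exp (-μ * η) := by
    rw [← Real.exp_add]; ring_nf
  have h2 : 1 - Real.exp (-μ * h) ≤ μ * h := by linarith [Real.add_one_le_exp (-μ * h)]
  have h3 : Real.exp (-μ * h) ≤ 1 := by
    rw [Real.exp_le_one_iff]; nlinarith
  rw [h1, abs_sub_comm, abs_of_nonneg (by nlinarith [Real.exp_pos (-μ * η)])]
  calc _ = (1 - Real.exp (-μ * h)) * Real.exp (-μ * η) := by ring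
    _ ≤ μ * h * Real.exp (-μ * η) := by gcongr
    _ = h * (μ * Real.exp (-μ * η)) := by ring
    _ ≤ h * (1 / η) := by gcongr; exact mul_exp_neg_mul_le hη μ
    _ = _ := by ring

theorem norm_add_add_sq_le {E : Type*} [SeminormedAddCommGroup E] (u v w : E) :
    ‖u + v + w‖ ^ 2 ≤ 3 * (‖u‖ ^ 2 + ‖v‖ ^ 2 + ‖w‖ ^ 2) := by
  have h1 : ‖u + v + w‖ ^ 2 ≤ (‖u‖ + ‖v‖ + ‖w‖) ^ 2 := by
    gcongr
    exact norm_add₃_le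
  nlinarith [sq_nonneg (‖u‖ - ‖v‖), sq_nonneg (‖u‖ - ‖w‖), sq_nonneg (‖v‖ - ‖w‖)]

variable {σ : ℕ → ℝ} {T : ℝ} {y f : ℝ → ell2} {i : ell2 →L[ℝ] ell2}

theorem IsMild.norm_sub_heat_sq_le_of_bound (h : IsMild σ T y f) (hy : Continuous y)
    (hf : Continuous f) {M : ℝ} (hM : ∀ t ∈ Icc 0 T, ‖f t‖ ≤ M) {s t : ℝ} (hs : 0 ≤ s)
    (hst : s ≤ t) (ht : t ≤ T) :
    ‖y t - heat σ (t - s) (y s)‖ ^ 2 ≤ 1 / 2 * M ^ 2 * (t - s) := by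
  refine (h.norm_sub_heat_sq_le hy hf hs hst ht).trans ?_
  have h2 : ∫ r in s..t, ‖f r‖ ^ 2 ≤ ∫ r in s..t, M ^ 2 := by
    refine intervalIntegral.integral_mono_on hst (Continuous.intervalIntegrable (by fun_prop) _ _)
      (Continuous.intervalIntegrable (by fun_prop) _ _) fun r hr => ?_
    gcongr
    exact hM r ⟨hs.trans hr.1, hr.2.trans ht⟩
  rw [intervalIntegral.integral_const, smul_eq_mul] at h2
  linarith

/-- Both values are compared with the free evolution from time $s-\eta$, $\eta=\sqrt{t-s}$. The two
free evolutions differ by at most $R(t-s)/\eta=R\eta$, and the squared remainders are $O(M^2\eta)$;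
this is Hölder continuity of exponent $1/4$. The hypothesis `hs` keeps $s-\eta$ nonnegative. -/
theorem IsMild.holder (h : IsMild σ T y f) (hy : Continuous y) (hf : Continuous f) {R M : ℝ}
    (hR : ∀ t ∈ Icc 0 T, ‖y t‖ ≤ R) (hM : ∀ t ∈ Icc 0 T, ‖f t‖ ≤ M) {s t : ℝ} (hst : s ≤ t)
    (ht : t ≤ T) (h1 : t - s ≤ 1) (hs : √(t - s) ≤ s) :
    ‖y t - y s‖ ^ 2 ≤ 3 * (R ^ 2 + 2 * M ^ 2) * √(t - s) := by
  rcases hst.eq_or_lt with rfl | hlt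
  · simp
  set η := √(t - s)
  have hh : 0 < t - s := sub_pos.2 hlt
  have hη : 0 < η := Real.sqrt_pos.2 hh
  have hη2 : η ^ 2 = t - s := Real.sq_sqrt hh.le
  have hη1 : η ≤ 1 := Real.sqrt_le_one.2 h1
  have ha := h.norm_sub_heat_sq_le_of_bound hy hf hM (s := s - η) (t := t) (by linarith)
    (by linarith) ht
  have hb := h.norm_sub_heat_sq_le_of_bound hy hf hM (s := s - η) (t := s) (by linarith)
    (by linarith) (by linarith)
  have hc := norm_heat_add_sub_heat_le σ hh.le hη (y (s - η))
  rw [show t - (s - η) = (t - s) + η by ring] at ha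
  rw [show s - (s - η) = η by ring] at hb
  have hc' : ‖heat σ (t - s + η) (y (s - η)) - heat σ η (y (s - η))‖ ^ 2 ≤ η * R ^ 2 := by
    have h3 : (t - s) / η = η := by rw [← hη2]; field_simp
    rw [h3] at hc
    calc _ ≤ (η * R) ^ 2 := by
          gcongr
          exact hc.trans (by gcongr; exact hR _ ⟨by linarith, by linarith⟩)
      _ = η * R ^ 2 * η := by ring
      _ ≤ _ := mul_le_of_le_one_right (by positivity) hη1
  have hsplit : y t - y s = (y t - heat σ (t - s + η) (y (s - η))) +
      (heat σ (t - s + η) (y (s - η)) - heat σ η (y (s - η))) +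
      (heat σ η (y (s - η)) - y s) := by abel
  rw [norm_sub_rev] at hb
  rw [hsplit]
  refine (norm_add_add_sq_le _ _ _).trans ?_
  have h4 : M ^ 2 * (t - s) ≤ M ^ 2 * η := by
    gcongr
    nlinarith
  nlinarith [sq_nonneg M, mul_nonneg (sq_nonneg M) hη.le]

/-- Jensen's inequality for a weight of mass $1-e^{-\mu(t-s)}\le1$, read off from $\int
w(g-m)^2\ge0$. -/
theorem sq_integral_exp_mul_le {μ s t : ℝ} {g : ℝ → ℝ} (hμ : 0 ≤ μ) (hst : s ≤ t)
    (hg : Continuous g) :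
    (∫ r in s..t, μ * Real.exp (-μ * (t - r)) * g r) ^ 2 ≤
      ∫ r in s..t, μ * Real.exp (-μ * (t - r)) * g r ^ 2 := by
  set m := ∫ r in s..t, μ * Real.exp (-μ * (t - r)) * g r
  have hw : ∫ r in s..t, μ * Real.exp (-μ * (t - r)) = 1 - Real.exp (-μ * (t - s)) := by
    have := sub_eq_integral_of_ode (u := fun r => Real.exp (-μ * (t - r)))
      (F := fun r => μ * Real.exp (-μ * (t - r))) hst (by fun_prop) (by fun_prop) fun r _ => by
        have h1 : HasDerivAt (fun r => Real.exp (-μ * (t - r)))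
            (Real.exp (-μ * (t - r)) * (-μ * (-1))) r :=
          (((hasDerivAt_id r).const_sub t).const_mul _).exp
        exact h1.congr_deriv (by ring)
    rw [← this]
    simp
  have h0 : 0 ≤ ∫ r in s..t, μ * Real.exp (-μ * (t - r)) * (g r - m) ^ 2 :=
    intervalIntegral.integral_nonneg hst fun r _ => by positivity
  have h1 : ∀ c, ∫ r in s..t, μ * Real.exp (-μ * (t - r)) * (g r - c) ^ 2 =
      (∫ r in s..t, μ * Real.exp (-μ * (t - r)) * g r ^ 2) -
        2 * c * (∫ r in s..t, μ * Real.exp (-μ * (t - r)) * g r) +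
        c ^ 2 * ∫ r in s..t, μ * Real.exp (-μ * (t - r)) := by
    intro c
    rw [← intervalIntegral.integral_const_mul, ← intervalIntegral.integral_const_mul,
      ← intervalIntegral.integral_sub (Continuous.intervalIntegrable (by fun_prop) _ _)
        (Continuous.intervalIntegrable (by fun_prop) _ _),
      ← intervalIntegral.integral_add (Continuous.intervalIntegrable (by fun_prop) _ _)
        (Continuous.intervalIntegrable (by fun_prop) _ _)]
    refine intervalIntegral.integral_congr fun r _ => ?_
    ring
  rw [h1, hw] at h0
  nlinarith [mul_nonneg (sq_nonneg m) (Real.exp_pos (-μ * (t - s))).le]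

theorem integral_rpow_neg_half (t η : ℝ) :
    ∫ r in (t - η)..t, (t - r) ^ (-(1 / 2) : ℝ) = 2 * √η := by
  rw [intervalIntegral.integral_comp_sub_left (fun x => x ^ (-(1 / 2) : ℝ)) t, sub_self,
    sub_sub_cancel, integral_rpow (Or.inl (by norm_num)), Real.sqrt_eq_rpow]
  rw [show (-(1 / 2) : ℝ) + 1 = 1 / 2 by norm_num, Real.zero_rpow (by norm_num)]
  ring

theorem intervalIntegrable_rpow_neg_half (t η : ℝ) :
    IntervalIntegrable (fun r => (t - r) ^ (-(1 / 2) : ℝ)) volume (t - η) t := by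
  have h : IntervalIntegrable (fun x : ℝ => x ^ (-(1 / 2) : ℝ)) volume η 0 :=
    intervalIntegral.intervalIntegrable_rpow' (by norm_num)
  simpa using h.comp_sub_left t

/-- The coordinates of the time derivative are approximated, up to `√η`, by those of a curve that
is smoothed by the semigroup at time `η`. -/
theorem IsMild.sum_sq_deriv_sub_le (h : IsMild σ T y f) (hy : Continuous y) (hf : Continuous f)
    {C t η : ℝ} (hη : 0 ≤ η) (htη : 0 ≤ t - η) (htT : t ≤ T)
    (hC : ∀ r ∈ Icc (t - η) t, ‖f r - f t‖ ^ 2 ≤ C * √(t - r)) (N : ℕ) :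
    ∑ n ∈ Finset.range N, (f t n - σ n * y t n -
      Real.exp (-(σ n ^ 2) * η) * (f t n - σ n * y (t - η) n)) ^ 2 ≤ C * (2 * √η) := by
  have hle : t - η ≤ t := by linarith
  have hg : ∀ n, Continuous fun r => f r n - f t n := fun n =>
    (continuous_coord_comp hf n).sub continuous_const
  have hcoord : ∀ n, f t n - σ n * y t n -
      Real.exp (-(σ n ^ 2) * η) * (f t n - σ n * y (t - η) n) =
      -∫ r in (t - η)..t, σ n ^ 2 * Real.exp (-(σ n ^ 2) * (t - r)) * (f r n - f t n) := by
    intro n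
    -- The subtracted term solves the equation with forcing frozen at $f(t)$, so only $f(r)-f(t)$
    -- remains as forcing. When $\sigma_n=0$ the division returns 0, which is still correct.
    have h1 := variation_of_constants (σ := σ n) (g := fun r => f r n - f t n)
      (u := fun r => y r n - f t n / σ n * (1 - Real.exp (-(σ n ^ 2) * (r - (t - η))))) hle
      (by have := continuous_coord_comp hy n; fun_prop) (hg n) fun r hr => by
        have h2 := h r ⟨htη.trans_lt hr.1, hr.2.trans_le htT⟩ n
        have h3 : HasDerivAt (fun r => Real.exp (-(σ n ^ 2) * (r - (t - η))))
            (Real.exp (-(σ n ^ 2) * (r - (t - η))) * (-(σ n ^ 2) * 1)) r :=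
          (((hasDerivAt_id r).sub_const _).const_mul _).exp
        refine (h2.fun_sub ((h3.const_sub 1).const_mul (f t n / σ n))).congr_deriv ?_
        rcases eq_or_ne (σ n) 0 with h0 | h0
        · simp [h0]
        · field_simp
          ring
    have h4 : ∫ r in (t - η)..t, σ n ^ 2 * Real.exp (-(σ n ^ 2) * (t - r)) * (f r n - f t n) =
        σ n * (σ n * ∫ r in (t - η)..t, Real.exp (-(σ n ^ 2) * (t - r)) * (f r n - f t n)) := by
      rw [← intervalIntegral.integral_const_mul, ← intervalIntegral.integral_const_mul]
      refine intervalIntegral.integral_congr fun r _ => ?_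
      ring
    rw [h4, ← sub_eq_iff_eq_add'.2 h1]
    simp only [sub_sub_cancel, sub_self, mul_zero, Real.exp_zero]
    rcases eq_or_ne (σ n) 0 with h0 | h0
    · simp [h0]
    · field_simp
      ring
  calc _ = ∑ n ∈ Finset.range N, (∫ r in (t - η)..t,
        σ n ^ 2 * Real.exp (-(σ n ^ 2) * (t - r)) * (f r n - f t n)) ^ 2 :=
        Finset.sum_congr rfl fun n _ => by rw [hcoord, neg_sq]
    _ ≤ ∑ n ∈ Finset.range N, ∫ r in (t - η)..t,
        σ n ^ 2 * Real.exp (-(σ n ^ 2) * (t - r)) * (f r n - f t n) ^ 2 :=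
        Finset.sum_le_sum fun n _ => sq_integral_exp_mul_le (sq_nonneg _) hle (hg n)
    _ = ∫ r in (t - η)..t, ∑ n ∈ Finset.range N,
        σ n ^ 2 * Real.exp (-(σ n ^ 2) * (t - r)) * (f r n - f t n) ^ 2 := by
        rw [intervalIntegral.integral_finsetSum fun n _ =>
          Continuous.intervalIntegrable (by have := hg n; fun_prop) _ _]
    _ ≤ ∫ r in (t - η)..t, C * (t - r) ^ (-(1 / 2) : ℝ) := by
        refine intervalIntegral.integral_mono_on hle
          (Continuous.intervalIntegrable (continuous_finsetSum _ fun n _ => by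
            have := hg n; fun_prop) _ _)
          ((intervalIntegrable_rpow_neg_half t η).const_mul C) fun r hr => ?_
        -- At $r=t$ both sides vanish, as $0^{-1/2}=0$ by convention. Elsewhere
        -- $\sigma^2e^{-\sigma^2\rho}\le1/\rho$ loses a full power of $\rho=t-r$ and the Hölder
        -- bound returns half of it, leaving an integrable singularity.
        rcases hr.2.eq_or_lt with rfl | hlt
        · simp
        · have hρ : 0 < t - r := sub_pos.2 hlt
          have h5 : (t - r) ^ (-(1 / 2) : ℝ) = 1 / (t - r) * √(t - r) := by
            rw [Real.rpow_neg hρ.le, ← Real.sqrt_eq_rpow]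
            field_simp
            rw [Real.sq_sqrt hρ.le]
          calc _ ≤ ∑ n ∈ Finset.range N, 1 / (t - r) * (f r n - f t n) ^ 2 :=
                Finset.sum_le_sum fun n _ =>
                  mul_le_mul_of_nonneg_right (mul_exp_neg_mul_le hρ _) (sq_nonneg _)
            _ = 1 / (t - r) * ∑ n ∈ Finset.range N, (f r - f t) n ^ 2 := by
                rw [Finset.mul_sum]; rfl
            _ ≤ 1 / (t - r) * (C * √(t - r)) := by
                gcongr
                exact (ell2.sum_sq_le _ _).trans (hC r hr)
            _ = _ := by rw [h5]; ring
    _ = _ := by rw [intervalIntegral.integral_const_mul, integral_rpow_neg_half t η]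

theorem abs_mul_exp_le (σ : ℝ) {η : ℝ} (hη : 0 < η) :
    |σ * Real.exp (-(σ ^ 2) * η)| ≤ 1 + 1 / η := by
  have h1 : |σ| ≤ 1 + σ ^ 2 := by
    rw [← sq_abs]; nlinarith [sq_nonneg (|σ| - 1), abs_nonneg σ]
  have h2 : Real.exp (-(σ ^ 2) * η) ≤ 1 := by
    rw [Real.exp_le_one_iff]; nlinarith [mul_nonneg (sq_nonneg σ) hη.le]
  rw [abs_mul, abs_of_pos (Real.exp_pos _)]
  calc _ ≤ (1 + σ ^ 2) * Real.exp (-(σ ^ 2) * η) := by gcongr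
    _ = Real.exp (-(σ ^ 2) * η) + σ ^ 2 * Real.exp (-(σ ^ 2) * η) := by ring
    _ ≤ _ := add_le_add h2 (mul_exp_neg_mul_le hη _)

/-- The smoothed curves `Q η` are continuous and approximate the modewise derivative $f-\sigma y$
uniformly on $[2\varepsilon,T]$, with squared error $O(\sqrt\eta)$. The limit is therefore a
continuous $\ell^2$ curve. -/
theorem IsMild.exists_continuousOn_deriv (h : IsMild σ T y f) (hy : Continuous y)
    (hf : Continuous f) {L : ℝ} (hL : ∀ s ∈ Icc 0 T, ∀ t ∈ Icc 0 T, ‖f s - f t‖ ≤ L * ‖y s - y t‖)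
    {ε : ℝ} (hε : 0 < ε) (hε1 : ε ≤ 1) :
    ∃ q : ℝ → ell2, ContinuousOn q (Icc (2 * ε) T) ∧
      ∀ t ∈ Icc (2 * ε) T, ∀ n, q t n = f t n - σ n * y t n := by
  obtain ⟨R, hR⟩ := exists_norm_le_on_Icc hy T
  obtain ⟨M, hM⟩ := exists_norm_le_on_Icc hf T
  set C := L ^ 2 * (3 * (R ^ 2 + 2 * M ^ 2))
  have hC0 : 0 ≤ C := by positivity
  have hC : ∀ t ∈ Icc (2 * ε) T, ∀ η, 0 < η → η ≤ ε ^ 2 → ∀ r ∈ Icc (t - η) t,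
      ‖f r - f t‖ ^ 2 ≤ C * √(t - r) := by
    intro t ht η hη hηε r hr
    -- From $t\ge2\varepsilon$ and $t-r\le\varepsilon^2$ follow $r\ge\varepsilon\ge\sqrt{t-r}$, as
    -- the Hölder estimate requires.
    have h1 : ε ^ 2 ≤ ε := by nlinarith
    have hr0 : ε ≤ r := by linarith [hr.1, ht.1]
    have h2 : √(t - r) ≤ ε := by
      rw [Real.sqrt_le_left hε.le]; linarith [hr.1]
    have h3 := h.holder hy hf hR hM hr.2 ht.2 (by linarith [hr.1]) (h2.trans hr0)
    calc _ ≤ (L * ‖y r - y t‖) ^ 2 := by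
          gcongr
          exact hL r ⟨by linarith, hr.2.trans ht.2⟩ t ⟨by linarith [hr.2], ht.2⟩
      _ = L ^ 2 * ‖y t - y r‖ ^ 2 := by rw [mul_pow, norm_sub_rev]
      _ ≤ L ^ 2 * (3 * (R ^ 2 + 2 * M ^ 2) * √(t - r)) := by gcongr
      _ = _ := by ring
  let Q : {η : ℝ // 0 < η} → ℝ → ell2 := fun η t => heat σ η (f t) -
    ell2.diag (fun n => σ n * Real.exp (-(σ n ^ 2) * η)) _
      (fun n => abs_mul_exp_le (σ n) η.2) (y (t - η))
  have hQc : ∀ η, Continuous (Q η) := fun η => by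
    refine ((heat σ η).continuous.comp hf).sub
      ((ContinuousLinearMap.continuous _).comp (hy.comp (continuous_sub_right _)))
  have hQn : ∀ η t n, Q η t n =
      Real.exp (-(σ n ^ 2) * η) * (f t n - σ n * y (t - η) n) := by
    intro η t n
    simp only [Q, lp.coeFn_sub, Pi.sub_apply, ell2.diag_apply, heat_apply σ η.2.le]
    ring
  have hsum : ∀ (η : {η : ℝ // 0 < η}), η.1 ≤ ε ^ 2 → ∀ t ∈ Icc (2 * ε) T, ∀ N,
      ∑ n ∈ Finset.range N, (f t n - σ n * y t n - Q η t n) ^ 2 ≤ C * (2 * √η) := by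
    intro η hη t ht N
    simp only [hQn]
    exact h.sum_sq_deriv_sub_le hy hf η.2.le (by nlinarith [ht.1]) ht.2 (hC t ht η η.2 hη) N
  let η₀ : {η : ℝ // 0 < η} := ⟨ε ^ 2, by positivity⟩
  -- Square summability of $f-\sigma y$ is not known beforehand; it comes from its distance to the
  -- one approximant `Q η₀`.
  let q : ℝ → ell2 := fun t => if ht : t ∈ Icc (2 * ε) T then
    ⟨fun n => f t n - σ n * y t n - Q η₀ t n, ell2.memℓp_of_sum_le (hsum η₀ le_rfl t ht)⟩ + Q η₀ t
    else 0
  have hq : ∀ t ∈ Icc (2 * ε) T, ∀ n, q t n = f t n - σ n * y t n := by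
    intro t ht n
    simp only [q, dif_pos ht, lp.coeFn_add, Pi.add_apply, sub_add_cancel]
  refine ⟨q, continuousOn_of_uniform_approx_of_continuousOn fun u hu => ?_, hq⟩
  obtain ⟨δ, hδ, hδu⟩ := Metric.mem_uniformity_dist.1 hu
  have hlim : Tendsto (fun η => C * (2 * √η)) (𝓝[>] (0 : ℝ)) (𝓝 0) := by
    have : Continuous fun η => C * (2 * √η) := by fun_prop
    have h1 := this.tendsto 0
    simp only [Real.sqrt_zero, mul_zero] at h1
    exact h1.mono_left nhdsWithin_le_nhds
  obtain ⟨η, hη1, hη2, hη3⟩ := ((hlim.eventually (gt_mem_nhds (show 0 < δ ^ 2 by positivity))).and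
    ((eventually_mem_nhdsWithin).and (mem_nhdsWithin_of_mem_nhds
      (Iic_mem_nhds (show 0 < ε ^ 2 by positivity))))).exists
  refine ⟨Q ⟨η, hη2⟩, (hQc _).continuousOn, fun t ht => hδu ?_⟩
  rw [dist_eq_norm]
  refine lt_of_pow_lt_pow_left₀ 2 hδ.le (lt_of_le_of_lt ?_ hη1)
  refine ell2.norm_sq_le_of_sum_le fun N => ?_
  simp only [lp.coeFn_sub, Pi.sub_apply, hq t ht]
  exact hsum ⟨η, hη2⟩ hη3 t ht N

/-- Near `t`, $iy$ is the integral of the continuous curve of modewise derivatives; this is checked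
coordinate by coordinate and then differentiated in $\ell^2$. -/
theorem IsMild.exists_hasDerivAt (hi : ∀ y n, y n = σ n * i y n) (hσ : ∀ n, σ n ≠ 0)
    (h : IsMild σ T y f) (hy : Continuous y)
    (hf : Continuous f) {L : ℝ} (hL : ∀ s ∈ Icc 0 T, ∀ t ∈ Icc 0 T, ‖f s - f t‖ ≤ L * ‖y s - y t‖)
    {t : ℝ} (ht : t ∈ Ioo 0 T) :
    ∃ q : ell2, (∀ n, q n = f t n - σ n * y t n) ∧ HasDerivAt (fun s => i (y s)) q t := by
  set ε := min 1 (t / 4)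
  have hε : 0 < ε := lt_min one_pos (by linarith [ht.1])
  have hεt : 2 * ε < t := by linarith [min_le_right 1 (t / 4), ht.1]
  obtain ⟨q, hqc, hq⟩ := h.exists_continuousOn_deriv hy hf hL hε (min_le_left _ _)
  have hle : 2 * ε ≤ T := hεt.le.trans ht.2.le
  let p : ℝ → ell2 := IccExtend hle ((Icc (2 * ε) T).domRestrict q)
  have hpc : Continuous p := (continuousOn_iff_continuous_domRestrict.1 hqc).Icc_extend'
  have hp : ∀ s ∈ Icc (2 * ε) T, p s = q s := fun s hs => by
    simp only [p, IccExtend_of_mem hle _ hs, domRestrict_apply]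
  have htI : t ∈ Icc (2 * ε) T := ⟨hεt.le, ht.2.le⟩
  refine ⟨q t, hq t htI, ?_⟩
  have h1 := (hpc.integral_hasStrictDerivAt t t).hasDerivAt.const_add (i (y t))
  rw [hp t htI] at h1
  refine h1.congr_of_eventuallyEq ?_
  filter_upwards [Ioo_mem_nhds hεt ht.2] with s hs
  ext n
  have hI : ∀ c ∈ uIcc t s, c ∈ Ioo 0 T := fun c hc => by
    obtain ⟨h3, h4⟩ := hc
    exact ⟨by linarith [(lt_min hεt hs.1).trans_le h3], h4.trans_lt (max_lt ht.2 hs.2)⟩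
  have hI' : ∀ c ∈ uIcc t s, c ∈ Icc (2 * ε) T := fun c hc => by
    obtain ⟨h3, h4⟩ := hc
    exact ⟨(lt_min hεt hs.1).le.trans h3, h4.trans (max_lt ht.2 hs.2).le⟩
  have h2 : ∫ r in t..s, p r n = i (y s) n - i (y t) n := by
    refine intervalIntegral.integral_eq_sub_of_hasDerivAt
      (f := fun r => i (y r) n) (fun r hr => ?_)
      ((continuous_coord_comp hpc n).intervalIntegrable _ _)
    rw [hp r (hI' r hr), hq r (hI' r hr)]
    exact hasDerivAt_inclusion_coord hi hσ h (hI r hr) n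
  have h3 : (∫ r in t..s, p r) n = ∫ r in t..s, p r n :=
    ((lp.evalCLM ℝ (fun _ : ℕ => ℝ) 2 n).intervalIntegral_comp_comm
      (hpc.intervalIntegrable _ _)).symm
  rw [lp.coeFn_add, Pi.add_apply, h3, h2]
  ring

/-- For $t\ge1$, $y(t)$ is the free evolution of $y(t-\eta)$ plus a remainder of squared norm at
most $\frac12M^2\eta$. For fixed small $\eta$ the semigroup damps the high modes uniformly over the
bounded trajectory; times in $[0,1]$ are covered by continuity. -/
theorem exists_isCompact_of_isMild (hσ : Tendsto (fun n => σ n ^ 2) atTop atTop)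
    (h : ∀ T, IsMild σ T y f) (hy : Continuous y) (hf : Continuous f) {R M : ℝ}
    (hR : ∀ t, 0 ≤ t → ‖y t‖ ≤ R) (hM : ∀ t, 0 ≤ t → ‖f t‖ ≤ M) :
    ∃ K : Set ell2, IsCompact K ∧ ∀ t, 0 ≤ t → y t ∈ K := by
  have htb : TotallyBounded (y '' Ici 1) := by
    refine ell2.totallyBounded_of_uniform_tails (R := R) ?_ fun ε hε => ?_
    · rintro _ ⟨t, ht, rfl⟩
      exact hR t (zero_le_one.trans ht)
    -- The remainder then contributes $2\cdot\frac12M^2\eta\le\varepsilon/2$, and the damped part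
    -- $2\cdot\varepsilon/4$.
    set η := min 1 (ε / (2 * (M ^ 2 + 1)))
    have hη : 0 < η := by positivity
    have hηε : M ^ 2 * η ≤ ε / 2 := by
      calc _ ≤ (M ^ 2 + 1) * (ε / (2 * (M ^ 2 + 1))) := by
            gcongr
            · linarith
            · exact min_le_right _ _
        _ = _ := by field_simp
    have hlim : Tendsto (fun n => 2 * R ^ 2 * Real.exp (-(σ n ^ 2) * η)) atTop (𝓝 0) := by
      have h1 : Tendsto (fun n => -(σ n ^ 2) * η) atTop atBot :=
        (tendsto_neg_atTop_atBot.comp hσ).atBot_mul_const hη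
      have h2 := (Real.tendsto_exp_atBot.comp h1).const_mul (2 * R ^ 2)
      simpa using h2
    obtain ⟨N, hN⟩ := eventually_atTop.1
      ((hlim.eventually (gt_mem_nhds (show 0 < ε / 2 by positivity))))
    refine ⟨N, ?_⟩
    rintro _ ⟨t, ht, rfl⟩ m
    have htη : 0 ≤ t - η := sub_nonneg.2 ((min_le_left _ _).trans ht)
    have h1 := (h t).norm_sub_heat_sq_le_of_bound hy hf (fun r hr => hM r hr.1) htη
      (by linarith) le_rfl
    rw [sub_sub_cancel] at h1
    set x := y (t - η)
    rcases le_total N m with hNm | hNm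
    swap
    · rw [Finset.Ico_eq_empty_of_le hNm, Finset.sum_empty]; exact hε.le
    have h2 : ∑ n ∈ Finset.Ico N m, heat σ η x n ^ 2 ≤ ε / 4 := by
      rcases eq_or_lt_of_le (sq_nonneg R) with hR0 | hR0
      · have h3 : ∑ n ∈ Finset.Ico N m, heat σ η x n ^ 2 ≤ ‖heat σ η x‖ ^ 2 := ell2.sum_sq_le _ _
        have h4 : ‖heat σ η x‖ ^ 2 ≤ R ^ 2 := by
          gcongr
          exact (norm_heat_le σ η x).trans (hR _ htη)
        linarith
      calc _ ≤ ∑ n ∈ Finset.Ico N m, ε / (4 * R ^ 2) * x n ^ 2 := by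
            refine Finset.sum_le_sum fun n hn => ?_
            rw [heat_apply σ hη.le, mul_pow]
            gcongr
            have h3 := hN n (Finset.mem_Ico.1 hn).1
            have h4 : Real.exp (-(σ n ^ 2) * η) ≤ 1 := by
              rw [Real.exp_le_one_iff]; nlinarith [mul_nonneg (sq_nonneg (σ n)) hη.le]
            have h5 : Real.exp (-(σ n ^ 2) * η) ^ 2 ≤ Real.exp (-(σ n ^ 2) * η) := by
              nlinarith [Real.exp_pos (-(σ n ^ 2) * η)]
            refine h5.trans ?_
            rw [le_div_iff₀ (by positivity)]
            linarith
        _ ≤ ε / (4 * R ^ 2) * R ^ 2 := by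
            rw [← Finset.mul_sum]
            gcongr
            refine (ell2.sum_sq_le x _).trans ?_
            gcongr
            exact hR _ htη
        _ = _ := by
            have hR1 : R ≠ 0 := fun h0 => by simp [h0] at hR0
            field_simp
    have h3 : ∑ n ∈ Finset.Ico N m, y t n ^ 2 ≤
        ∑ n ∈ Finset.Ico N m, (2 * heat σ η x n ^ 2 + 2 * (y t - heat σ η x) n ^ 2) := by
      refine Finset.sum_le_sum fun n _ => ?_
      rw [lp.coeFn_sub, Pi.sub_apply]
      nlinarith [sq_nonneg (y t n - 2 * heat σ η x n)]
    rw [Finset.sum_add_distrib, ← Finset.mul_sum, ← Finset.mul_sum] at h3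
    have h4 := ell2.sum_sq_le (y t - heat σ η x) (Finset.Ico N m)
    linarith
  refine ⟨closure (y '' Icc 0 1 ∪ y '' Ici 1), ?_, fun t ht => subset_closure ?_⟩
  · exact ((isCompact_Icc.image hy).totallyBounded.union htb).closure.isCompact_of_isClosed
      isClosed_closure
  · rw [← image_union, Icc_union_Ici_eq_Ici zero_le_one]
    exact mem_image_of_mem y ht

end Regularity

/-! ### Fourier series in `L²(-π, π)` -/

theorem integral_mu (f : ℝ → ℝ) : ∫ x, f x ∂mu = ∫ x in (-Real.pi)..Real.pi, f x := by
  rw [intervalIntegral.integral_of_le (by linarith [Real.pi_pos]), integral_Ioc_eq_integral_Ioo]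

theorem memLp_of_continuous {f : ℝ → ℝ} (hf : Continuous f) (p : ℝ≥0∞) : MemLp f p mu := by
  obtain ⟨C, hC⟩ := (isCompact_Icc (a := -Real.pi) (b := Real.pi)).exists_bound_of_continuousOn
    hf.continuousOn
  refine MemLp.of_bound (C := C) hf.aestronglyMeasurable ?_
  filter_upwards [ae_restrict_mem measurableSet_Ioo] with x hx
  exact hC x (Ioo_subset_Icc_self hx)

/-- The class in `L²(-π, π)` of a continuous function. -/
noncomputable def ofCont (f : ℝ → ℝ) (hf : Continuous f) : L2 := (memLp_of_continuous hf 2).toLp f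

theorem coeFn_ofCont {f : ℝ → ℝ} (hf : Continuous f) : ofCont f hf =ᵐ[mu] f := MemLp.coeFn_toLp _

theorem inner_ofCont {f : ℝ → ℝ} (hf : Continuous f) (g : L2) :
    inner ℝ (ofCont f hf) g = ∫ x, g x * f x ∂mu := by
  rw [L2.inner_def]
  refine integral_congr_ae ?_
  filter_upwards [coeFn_ofCont hf] with x hx
  rw [hx]
  rfl

theorem inner_ofCont_ofCont {f g : ℝ → ℝ} (hf : Continuous f) (hg : Continuous g) :
    inner ℝ (ofCont f hf) (ofCont g hg) = ∫ x in (-Real.pi)..Real.pi, f x * g x := by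
  rw [inner_ofCont, ← integral_mu]
  refine integral_congr_ae ?_
  filter_upwards [coeFn_ofCont hg] with x hx
  rw [hx, mul_comm]

/-- The function `(1/π)^{1/2} sin (k x)`, `k = n + 1`. -/
noncomputable def sine (n : ℕ) (x : ℝ) : ℝ := √(1 / Real.pi) * Real.sin (((n : ℝ) + 1) * x)

/-- The function `(1/π)^{1/2} cos (k x)`, `k = n + 1`. -/
noncomputable def cosine (n : ℕ) (x : ℝ) : ℝ := √(1 / Real.pi) * Real.cos (((n : ℝ) + 1) * x)

theorem continuous_sine (n : ℕ) : Continuous (sine n) := by unfold sine; fun_prop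

theorem continuous_cosine (n : ℕ) : Continuous (cosine n) := by unfold cosine; fun_prop

theorem hasDerivAt_sine (n : ℕ) (x : ℝ) : HasDerivAt (sine n) (((n : ℝ) + 1) * cosine n x) x := by
  refine ((((hasDerivAt_id x).const_mul ((n : ℝ) + 1)).sin).const_mul
    √(1 / Real.pi)).congr_deriv ?_
  simp only [cosine, id]
  ring

theorem hasDerivAt_cosine (n : ℕ) (x : ℝ) :
    HasDerivAt (cosine n) (-(((n : ℝ) + 1) * sine n x)) x := by
  refine ((((hasDerivAt_id x).const_mul ((n : ℝ) + 1)).cos).const_mul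
    √(1 / Real.pi)).congr_deriv ?_
  simp only [sine, id]
  ring

theorem deriv_sine (n : ℕ) : deriv (sine n) = fun x => ((n : ℝ) + 1) * cosine n x :=
  funext fun x => (hasDerivAt_sine n x).deriv

theorem deriv_cosine (n : ℕ) : deriv (cosine n) = fun x => -(((n : ℝ) + 1) * sine n x) :=
  funext fun x => (hasDerivAt_cosine n x).deriv

theorem isTest_sine (n : ℕ) : IsTest (sine n) := by
  refine ⟨by unfold sine; fun_prop, fun x => ?_⟩
  have := Real.sin_add_nat_mul_two_pi (((n : ℝ) + 1) * x) (n + 1)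
  push_cast at this
  rw [sine, sine, mul_add, this]

theorem isTest_cosine (n : ℕ) : IsTest (cosine n) := by
  refine ⟨by unfold cosine; fun_prop, fun x => ?_⟩
  have := Real.cos_add_nat_mul_two_pi (((n : ℝ) + 1) * x) (n + 1)
  push_cast at this
  rw [cosine, cosine, mul_add, this]

theorem eigenfunction_eq (n : ℕ) : eigenfunction n = ofCont (sine n) (continuous_sine n) := rfl

/-- The cosines `(1/π)^{1/2} cos (k x)`, `k = n + 1`, as elements of `L²(-π, π)`. -/
noncomputable def cosineL2 (n : ℕ) : L2 := ofCont (cosine n) (continuous_cosine n)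

theorem integral_cos_int_mul (k : ℤ) :
    ∫ x in (-Real.pi)..Real.pi, Real.cos (k * x) = if k = 0 then 2 * Real.pi else 0 := by
  split_ifs with hk
  · simp [hk]; ring
  · have hk' : (k : ℝ) ≠ 0 := by exact_mod_cast hk
    rw [intervalIntegral.integral_comp_mul_left (fun x => Real.cos x) hk', integral_cos]
    simp [Real.sin_int_mul_pi]

theorem integral_sine_mul_sine (n m : ℕ) :
    ∫ x in (-Real.pi)..Real.pi, sine n x * sine m x = if n = m then 1 else 0 := by
  have h1 : ∀ x, sine n x * sine m x = 1 / (2 * Real.pi) * Real.cos (((n - m : ℤ) : ℝ) * x) -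
      1 / (2 * Real.pi) * Real.cos (((n + m + 2 : ℤ) : ℝ) * x) := by
    intro x
    have h2 : √(1 / Real.pi) * √(1 / Real.pi) = 1 / Real.pi :=
      Real.mul_self_sqrt (by positivity)
    have h3 : ((n - m : ℤ) : ℝ) * x = ((n : ℝ) + 1) * x - ((m : ℝ) + 1) * x := by push_cast; ring
    have h4 : ((n + m + 2 : ℤ) : ℝ) * x = ((n : ℝ) + 1) * x + ((m : ℝ) + 1) * x := by
      push_cast; ring
    rw [h3, h4, Real.cos_sub, Real.cos_add, sine, sine, mul_mul_mul_comm, h2]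
    field_simp
    ring
  simp_rw [h1]
  rw [intervalIntegral.integral_sub (Continuous.intervalIntegrable (by fun_prop) _ _)
    (Continuous.intervalIntegrable (by fun_prop) _ _), intervalIntegral.integral_const_mul,
    intervalIntegral.integral_const_mul, integral_cos_int_mul, integral_cos_int_mul,
    if_neg (show (n + m + 2 : ℤ) ≠ 0 by omega)]
  rcases eq_or_ne n m with rfl | h
  · simp only [sub_self, if_true]
    field_simp
    ring
  · rw [if_neg (by omega), if_neg h]; simp

theorem integral_cosine_mul_cosine (n m : ℕ) :
    ∫ x in (-Real.pi)..Real.pi, cosine n x * cosine m x = if n = m then 1 else 0 := by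
  have h1 : ∀ x, cosine n x * cosine m x = 1 / (2 * Real.pi) * Real.cos (((n - m : ℤ) : ℝ) * x) +
      1 / (2 * Real.pi) * Real.cos (((n + m + 2 : ℤ) : ℝ) * x) := by
    intro x
    have h2 : √(1 / Real.pi) * √(1 / Real.pi) = 1 / Real.pi :=
      Real.mul_self_sqrt (by positivity)
    have h3 : ((n - m : ℤ) : ℝ) * x = ((n : ℝ) + 1) * x - ((m : ℝ) + 1) * x := by push_cast; ring
    have h4 : ((n + m + 2 : ℤ) : ℝ) * x = ((n : ℝ) + 1) * x + ((m : ℝ) + 1) * x := by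
      push_cast; ring
    rw [h3, h4, Real.cos_sub, Real.cos_add, cosine, cosine, mul_mul_mul_comm, h2]
    field_simp
    ring
  simp_rw [h1]
  rw [intervalIntegral.integral_add (Continuous.intervalIntegrable (by fun_prop) _ _)
    (Continuous.intervalIntegrable (by fun_prop) _ _), intervalIntegral.integral_const_mul,
    intervalIntegral.integral_const_mul, integral_cos_int_mul, integral_cos_int_mul,
    if_neg (show (n + m + 2 : ℤ) ≠ 0 by omega)]
  rcases eq_or_ne n m with rfl | h
  · simp only [sub_self, if_true]
    field_simp
    ring
  · rw [if_neg (by omega), if_neg h]; simp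

theorem orthonormal_eigenfunction : Orthonormal ℝ eigenfunction :=
  orthonormal_iff_ite.2 fun n m => by
    rw [eigenfunction_eq, eigenfunction_eq, inner_ofCont_ofCont, integral_sine_mul_sine]

theorem orthonormal_cosineL2 : Orthonormal ℝ cosineL2 :=
  orthonormal_iff_ite.2 fun n m => by
    rw [cosineL2, cosineL2, inner_ofCont_ofCont, integral_cosine_mul_cosine]

theorem sqrt_one_div_pi_pos : 0 < √(1 / Real.pi) := Real.sqrt_pos.2 (by positivity)

theorem fourierCoeffOn_eq_zero {f : L2} (h0 : ∫ x, f x ∂mu = 0)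
    (hs : ∀ n, inner ℝ (eigenfunction n) f = 0) (hc : ∀ n, inner ℝ (cosineL2 n) f = 0) (k : ℤ) :
    fourierCoeffOn (show -Real.pi < Real.pi by linarith [Real.pi_pos])
      (fun x => ((f x : ℝ) : ℂ)) k = 0 := by
  have hsin : ∀ n : ℕ, ∫ x, f x * Real.sin (((n : ℝ) + 1) * x) ∂mu = 0 := by
    intro n
    have := hs n
    rw [eigenfunction_eq, inner_ofCont] at this
    simp only [sine, mul_left_comm _ √(1 / Real.pi), integral_const_mul] at this
    exact (mul_eq_zero.1 this).resolve_left sqrt_one_div_pi_pos.ne'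
  have hcos : ∀ n : ℕ, ∫ x, f x * Real.cos (((n : ℝ) + 1) * x) ∂mu = 0 := by
    intro n
    have := hc n
    rw [cosineL2, inner_ofCont] at this
    simp only [cosine, mul_left_comm _ √(1 / Real.pi), integral_const_mul] at this
    exact (mul_eq_zero.1 this).resolve_left sqrt_one_div_pi_pos.ne'
  have hsin' : ∫ x, f x * Real.sin (k * x) ∂mu = 0 := by
    obtain ⟨m, rfl | rfl⟩ := k.eq_nat_or_neg <;> rcases m with _ | m
    · simp
    · simpa using hsin m
    · simp
    · have := hsin m
      simp only [Int.cast_neg, Int.cast_natCast, neg_mul, Real.sin_neg, mul_neg, integral_neg,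
        neg_eq_zero]
      simpa using this
  have hcos' : ∫ x, f x * Real.cos (k * x) ∂mu = 0 := by
    obtain ⟨m, rfl | rfl⟩ := k.eq_nat_or_neg <;> rcases m with _ | m
    · simpa using h0
    · simpa using hcos m
    · simpa using h0
    · have := hcos m
      simp only [Int.cast_neg, Int.cast_natCast, neg_mul, Real.cos_neg]
      simpa using this
  have hint : ∀ {g : ℝ → ℝ}, Continuous g → Integrable (fun x => f x * g x) mu := fun hg =>
    (Lp.memLp f).integrable_mul (memLp_of_continuous hg 2)
  rw [fourierCoeffOn_eq_integral, intervalIntegral.integral_of_le (by linarith [Real.pi_pos]),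
    integral_Ioc_eq_integral_Ioo]
  have h1 : ∀ x : ℝ, fourier (-k) (x : AddCircle (Real.pi - -Real.pi)) • ((f x : ℝ) : ℂ) =
      ((f x * Real.cos (k * x) : ℝ) : ℂ) - Complex.I * ((f x * Real.sin (k * x) : ℝ) : ℂ) := by
    intro x
    rw [fourier_coe_apply]
    have h2 : 2 * (Real.pi : ℂ) * Complex.I * ((-k : ℤ) : ℂ) * x / ((Real.pi - -Real.pi : ℝ) : ℂ) =
        ((-(k * x) : ℝ) : ℂ) * Complex.I := by
      have : (Real.pi : ℂ) ≠ 0 := by exact_mod_cast Real.pi_ne_zero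
      push_cast
      field_simp
      ring
    rw [h2, Complex.exp_mul_I, ← Complex.ofReal_cos, ← Complex.ofReal_sin, Real.cos_neg,
      Real.sin_neg, smul_eq_mul]
    push_cast
    ring
  simp_rw [h1]
  rw [integral_sub (hint (by fun_prop)).ofReal ((hint (by fun_prop)).ofReal.const_mul _),
    integral_const_mul, integral_complex_ofReal, integral_complex_ofReal, hsin', hcos']
  simp

/-- Completeness of the real trigonometric system is inherited from the complex Parseval identity.
-/
theorem eq_zero_of_fourier {f : L2} (h0 : ∫ x, f x ∂mu = 0)
    (hs : ∀ n, inner ℝ (eigenfunction n) f = 0) (hc : ∀ n, inner ℝ (cosineL2 n) f = 0) :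
    f = 0 := by
  have hpi : -Real.pi < Real.pi := by linarith [Real.pi_pos]
  have hmu : (volume.restrict (Ioc (-Real.pi) Real.pi) : Measure ℝ) = mu :=
    (restrict_Ioo_eq_restrict_Ioc).symm
  have h1 := hasSum_sq_fourierCoeffOn hpi (f := fun x => ((f x : ℝ) : ℂ))
    (by rw [hmu]; exact (Lp.memLp f).ofReal)
  simp only [fourierCoeffOn_eq_zero h0 hs hc, norm_zero, ne_eq, OfNat.ofNat_ne_zero,
    not_false_eq_true, zero_pow] at h1
  have h2 := h1.unique hasSum_zero
  rw [smul_eq_zero] at h2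
  have h3 := h2.resolve_left (inv_ne_zero (by linarith))
  rw [← norm_eq_zero, ← sq_eq_zero_iff, ← real_inner_self_eq_norm_sq, L2.inner_def]
  rw [← integral_mu] at h3
  rw [← h3]
  refine integral_congr_ae (Eventually.of_forall fun x => ?_)
  simp [sq]

/-! ### Synthesis of odd and even functions -/

/-- The isometry of `ℓ²` into `L²(-π, π)` defined by an orthonormal sequence. -/
noncomputable def synth {v : ℕ → L2} (hv : Orthonormal ℝ v) : ell2 →ₗᵢ[ℝ] L2 :=
  hv.orthogonalFamily.linearIsometry

section Synth

variable {v : ℕ → L2} (hv : Orthonormal ℝ v)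

theorem hasSum_synth (c : ell2) : HasSum (fun n => c n • v n) (synth hv c) := by
  have := hv.orthogonalFamily.hasSum_linearIsometry c
  simpa [synth, LinearIsometry.toSpanSingleton_apply] using this

/-- The coefficients of a function with respect to an orthonormal sequence. -/
noncomputable def coeffs : L2 →L[ℝ] ell2 :=
  ContinuousLinearMap.adjoint (synth hv).toContinuousLinearMap

theorem inner_coeffs (c : ell2) (f : L2) : inner ℝ c (coeffs hv f) = inner ℝ (synth hv c) f :=
  ContinuousLinearMap.adjoint_inner_right _ _ _

theorem synth_single (n : ℕ) : synth hv (lp.single 2 n 1) = v n := by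
  simp [synth, OrthogonalFamily.linearIsometry_apply_single, LinearIsometry.toSpanSingleton_apply]

theorem coeffs_apply (f : L2) (n : ℕ) : coeffs hv f n = inner ℝ (v n) f := by
  have h1 := inner_coeffs hv (lp.single 2 n 1) f
  rw [synth_single, lp.inner_single_left] at h1
  simpa using h1

theorem coeffs_synth (c : ell2) : coeffs hv (synth hv c) = c := by
  refine ext_inner_left ℝ fun d => ?_
  rw [inner_coeffs, LinearIsometry.inner_map_map]

theorem inner_synth (c : ell2) (n : ℕ) : inner ℝ (v n) (synth hv c) = c n := by
  rw [← coeffs_apply hv, coeffs_synth]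

end Synth

/-- The reflection `f(x) ↦ f(-x)` of `L²(-π, π)`. -/
noncomputable def reflect : L2 →ₗᵢ[ℝ] L2 :=
  Lp.compMeasurePreservingₗᵢ ℝ (fun x => -x) measurePreserving_neg_mu

theorem coeFn_reflect (f : L2) : reflect f =ᵐ[mu] fun x => f (-x) :=
  Lp.coeFn_compMeasurePreserving f measurePreserving_neg_mu

theorem reflect_ofCont {f g : ℝ → ℝ} (hf : Continuous f) (hg : Continuous g)
    (h : ∀ x, f (-x) = g x) : reflect (ofCont f hf) = ofCont g hg := by
  refine Lp.ext ?_
  filter_upwards [coeFn_reflect (ofCont f hf), coeFn_ofCont hg,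
    measurePreserving_neg_mu.quasiMeasurePreserving.ae (coeFn_ofCont hf)] with x h1 h2 h3
  rw [h1, h2, h3, h]

theorem mem_L2op_iff {f : L2} : f ∈ L2op ↔ reflect f = -f := by
  constructor
  · intro h
    refine Lp.ext ?_
    have h' : ∀ᵐ x ∂mu, f (-x) = -f x := h
    filter_upwards [coeFn_reflect f, Lp.coeFn_neg f, h'] with x h1 h2 h3
    rw [h1, h2, h3, Pi.neg_apply]
  · intro h
    change ∀ᵐ x ∂mu, f (-x) = -f x
    have h4 := Lp.coeFn_neg f
    rw [← h] at h4
    filter_upwards [coeFn_reflect f, h4] with x h1 h2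
    rw [← h1, h2, Pi.neg_apply]

theorem eigenfunction_mem (n : ℕ) : eigenfunction n ∈ L2op := by
  rw [mem_L2op_iff, eigenfunction_eq,
    reflect_ofCont (continuous_sine n) (g := fun x => -sine n x) (continuous_sine n).neg
      fun x => by simp [sine]]
  refine Lp.ext ?_
  filter_upwards [coeFn_ofCont (f := fun x => -sine n x) (continuous_sine n).neg,
    coeFn_ofCont (continuous_sine n),
    Lp.coeFn_neg (ofCont (sine n) (continuous_sine n))] with x h1 h2 h3
  rw [h3, Pi.neg_apply, h2, h1]

theorem reflect_cosineL2 (n : ℕ) : reflect (cosineL2 n) = cosineL2 n :=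
  reflect_ofCont _ _ fun x => by simp [cosine]

theorem inner_eq_zero_of_even_of_odd {f g : L2} (hf : reflect f = f) (hg : g ∈ L2op) :
    inner ℝ f g = 0 := by
  have h1 := reflect.inner_map_map f g
  rw [hf, mem_L2op_iff.1 hg, inner_neg_right] at h1
  linarith

/-- The sum of a sine series. -/
noncomputable abbrev sineSeries : ell2 →ₗᵢ[ℝ] L2 := synth orthonormal_eigenfunction

/-- The sum of a cosine series without constant term. -/
noncomputable abbrev cosineSeries : ell2 →ₗᵢ[ℝ] L2 := synth orthonormal_cosineL2

/-- The sine coefficients of a function. -/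
noncomputable abbrev sineCoeffs : L2 →L[ℝ] ell2 := coeffs orthonormal_eigenfunction

theorem sineSeries_mem (c : ell2) : sineSeries c ∈ L2op := by
  rw [mem_L2op_iff]
  have h1 := hasSum_synth orthonormal_eigenfunction c
  have h2 := h1.mapL reflect.toContinuousLinearMap
  simp only [LinearIsometry.coe_toContinuousLinearMap, map_smul,
    mem_L2op_iff.1 (eigenfunction_mem _), smul_neg] at h2
  exact h2.unique h1.neg

theorem reflect_cosineSeries (c : ell2) : reflect (cosineSeries c) = cosineSeries c := by
  have h1 := hasSum_synth orthonormal_cosineL2 c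
  have h2 := h1.mapL reflect.toContinuousLinearMap
  simp only [LinearIsometry.coe_toContinuousLinearMap, map_smul, reflect_cosineL2] at h2
  exact h2.unique h1

/-- Parity makes an odd function orthogonal to constants and cosines. -/
theorem eq_zero_of_odd {f : L2} (hf : f ∈ L2op) (hs : ∀ n, inner ℝ (eigenfunction n) f = 0) :
    f = 0 := by
  refine eq_zero_of_fourier ?_ hs
    fun n => inner_eq_zero_of_even_of_odd (reflect_cosineL2 n) hf
  have h1 := inner_eq_zero_of_even_of_odd
    (reflect_ofCont (f := fun _ => 1) continuous_const continuous_const fun _ => rfl) hf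
  rw [inner_ofCont] at h1
  simpa using h1

theorem sineSeries_sineCoeffs {f : L2} (hf : f ∈ L2op) : sineSeries (sineCoeffs f) = f := by
  rw [← sub_eq_zero]
  refine eq_zero_of_odd (L2op.sub_mem (sineSeries_mem _) hf) fun n => ?_
  rw [inner_sub_right, ← coeffs_apply orthonormal_eigenfunction, coeffs_synth,
    coeffs_apply, sub_self]

/-! ### Weak derivatives of sine and cosine series -/

theorem IsTest.continuous {φ : ℝ → ℝ} (h : IsTest φ) : Continuous φ := h.1.continuous

theorem IsTest.differentiable {φ : ℝ → ℝ} (h : IsTest φ) : Differentiable ℝ φ :=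
  h.1.differentiable (by simp)

theorem IsTest.deriv {φ : ℝ → ℝ} (h : IsTest φ) : IsTest (deriv φ) := by
  refine ⟨?_, fun x => ?_⟩
  · exact ((contDiff_infty_iff_deriv (𝕜 := ℝ)).1 h.1).2
  · rw [← deriv_comp_add_const, h.2.funext]

theorem integral_mul_deriv_of_isTest {φ ψ : ℝ → ℝ} (hφ : IsTest φ) (hψ : IsTest ψ) :
    ∫ x in (-Real.pi)..Real.pi, φ x * deriv ψ x =
      -∫ x in (-Real.pi)..Real.pi, deriv φ x * ψ x := by
  rw [intervalIntegral.integral_mul_deriv_eq_deriv_mul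
    (fun x _ => (hφ.differentiable x).hasDerivAt) (fun x _ => (hψ.differentiable x).hasDerivAt)
    (hφ.deriv.continuous.intervalIntegrable _ _) (hψ.deriv.continuous.intervalIntegrable _ _)]
  have h1 : φ Real.pi = φ (-Real.pi) := by
    rw [← hφ.2 (-Real.pi)]; congr 1; ring
  have h2 : ψ Real.pi = ψ (-Real.pi) := by
    rw [← hψ.2 (-Real.pi)]; congr 1; ring
  rw [h1, h2, sub_self, zero_sub]

theorem isWeakDeriv_iff {f g : L2} : IsWeakDeriv f g ↔ ∀ (φ : ℝ → ℝ) (h : IsTest φ),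
    inner ℝ (ofCont (deriv φ) h.deriv.continuous) f = -inner ℝ (ofCont φ h.continuous) g := by
  simp only [IsWeakDeriv, inner_ofCont]

theorem isWeakDeriv₂_iff {f g : L2} : IsWeakDeriv₂ f g ↔ ∀ (φ : ℝ → ℝ) (h : IsTest φ),
    inner ℝ (ofCont (deriv (deriv φ)) h.deriv.deriv.continuous) f =
      inner ℝ (ofCont φ h.continuous) g := by
  simp only [IsWeakDeriv₂, inner_ofCont]

theorem IsWeakDeriv.isWeakDeriv₂ {f g h : L2} (hfg : IsWeakDeriv f g) (hgh : IsWeakDeriv g h) :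
    IsWeakDeriv₂ f h := fun φ hφ => by
  rw [hfg _ hφ.deriv, hgh φ hφ, neg_neg]

/-- For a fixed test function both sides are continuous functionals on $L^2$, so the identity passes
through the series term by term. -/
theorem isWeakDeriv_synth {v w : ℕ → L2} (hv : Orthonormal ℝ v) (hw : Orthonormal ℝ w)
    {k : ℕ → ℝ} (hvw : ∀ n, IsWeakDeriv (v n) (k n • w n)) {c d : ell2}
    (hcd : ∀ n, d n = k n * c n) : IsWeakDeriv (synth hv c) (synth hw d) := by
  rw [isWeakDeriv_iff]
  intro φ hφ
  have h1 := (hasSum_synth hv c).mapL (innerSL ℝ (ofCont (deriv φ) hφ.deriv.continuous))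
  have h2 := ((hasSum_synth hw d).mapL (innerSL ℝ (ofCont φ hφ.continuous))).neg
  refine h1.unique (h2.congr_fun ?_)
  intro n
  have h3 := isWeakDeriv_iff.1 (hvw n) φ hφ
  rw [inner_smul_right] at h3
  simp only [innerSL_apply_apply, inner_smul_right, h3, hcd]
  ring

theorem isWeakDeriv_ofCont {φ : ℝ → ℝ} (hφ : IsTest φ) :
    IsWeakDeriv (ofCont φ hφ.continuous) (ofCont (deriv φ) hφ.deriv.continuous) := by
  rw [isWeakDeriv_iff]
  intro ψ hψ
  rw [inner_ofCont_ofCont, inner_ofCont_ofCont]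
  simp only [mul_comm (deriv ψ _), mul_comm (ψ _)]
  exact integral_mul_deriv_of_isTest hφ hψ

theorem isWeakDeriv_eigenfunction (n : ℕ) :
    IsWeakDeriv (eigenfunction n) (((n : ℝ) + 1) • cosineL2 n) := by
  have := isWeakDeriv_ofCont (isTest_sine n)
  simp only [deriv_sine] at this
  exact this

theorem isWeakDeriv_cosineL2 (n : ℕ) :
    IsWeakDeriv (cosineL2 n) ((-((n : ℝ) + 1)) • eigenfunction n) := by
  have := isWeakDeriv_ofCont (isTest_cosine n)
  simp only [deriv_cosine, ← neg_mul] at this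
  exact this

theorem IsWeakDeriv.unique {f g g' : L2} (h : IsWeakDeriv f g) (h' : IsWeakDeriv f g') :
    g = g' := by
  have key : ∀ (φ : ℝ → ℝ) (hφ : IsTest φ), inner ℝ (ofCont φ hφ.continuous) (g - g') = 0 := by
    intro φ hφ
    have h1 := isWeakDeriv_iff.1 h φ hφ
    rw [isWeakDeriv_iff.1 h' φ hφ, neg_inj] at h1
    rw [inner_sub_right, h1, sub_self]
  rw [← sub_eq_zero]
  refine eq_zero_of_fourier ?_ (fun n => key _ (isTest_sine n)) fun n => key _ (isTest_cosine n)
  have := key (fun _ => 1) ⟨contDiff_const, fun _ => rfl⟩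
  rw [inner_ofCont] at this
  simpa using this

theorem IsWeakDeriv.inner_cosineL2 {f g : L2} (h : IsWeakDeriv f g) (n : ℕ) :
    inner ℝ (cosineL2 n) g = ((n : ℝ) + 1) * inner ℝ (eigenfunction n) f := by
  have h1 := isWeakDeriv_iff.1 h _ (isTest_cosine n)
  have h2 : ofCont (deriv (cosine n)) (isTest_cosine n).deriv.continuous =
      (-((n : ℝ) + 1)) • eigenfunction n := by
    simp only [deriv_cosine, ← neg_mul]
    rfl
  rw [h2, inner_smul_left] at h1
  simp only [conj_trivial] at h1
  have h3 : inner ℝ (cosineL2 n) g = inner ℝ (ofCont (cosine n) (isTest_cosine n).continuous) g :=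
    rfl
  linarith

theorem IsWeakDeriv₂.inner_eigenfunction {f h : L2} (hh : IsWeakDeriv₂ f h) (n : ℕ) :
    inner ℝ (eigenfunction n) h = -((n : ℝ) + 1) ^ 2 * inner ℝ (eigenfunction n) f := by
  have h1 := isWeakDeriv₂_iff.1 hh _ (isTest_sine n)
  have h2 : deriv (deriv (sine n)) = fun x => -((n : ℝ) + 1) ^ 2 * sine n x := by
    rw [deriv_sine]
    funext x
    rw [((hasDerivAt_cosine n x).const_mul _).deriv]
    ring
  have h3 : ofCont (deriv (deriv (sine n))) (isTest_sine n).deriv.deriv.continuous =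
      (-((n : ℝ) + 1) ^ 2) • eigenfunction n := by
    simp only [h2]
    rfl
  rw [h3, inner_smul_left] at h1
  simp only [conj_trivial] at h1
  exact h1.symm

/-! ### The sup bound -/

/-- The function `(1/π)^{1/2} sin (k x)`, `k = n + 1`, as a bounded continuous function. -/
noncomputable def sineBCF (n : ℕ) : BoundedContinuousFunction ℝ ℝ :=
  BoundedContinuousFunction.ofNormedAddCommGroup (sine n) (continuous_sine n) 1 fun x => by
    rw [sine, norm_mul, Real.norm_of_nonneg (Real.sqrt_nonneg _)]
    refine mul_le_one₀ (Real.sqrt_le_one.2 ?_) (norm_nonneg _) (Real.abs_sin_le_one _)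
    rw [div_le_one Real.pi_pos]
    linarith [Real.pi_gt_three]

theorem norm_sineBCF_le (n : ℕ) : ‖sineBCF n‖ ≤ 1 :=
  BoundedContinuousFunction.norm_ofNormedAddCommGroup_le _ zero_le_one _

theorem memℓp_inv : Memℓp (E := fun _ : ℕ => ℝ) (fun n : ℕ => 1 / ((n : ℝ) + 1)) 2 := by
  rw [memℓp_gen_iff (by norm_num)]
  have := (summable_nat_add_iff 1).2 (Real.summable_one_div_nat_pow.2 one_lt_two)
  simpa using this

/-- The sequence `1 / k`, `k = 1, 2, …`. -/
noncomputable def invSeq : ell2 := ⟨fun n => 1 / ((n : ℝ) + 1), memℓp_inv⟩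

/-- Cauchy–Schwarz against $1/k$: this is the embedding of $H^1$ in the bounded functions. -/
theorem sum_norm_smul_sineBCF_le (d : ell2) (N : ℕ) :
    ∑ n ∈ Finset.range N, ‖(d n / ((n : ℝ) + 1)) • sineBCF n‖ ≤ ‖invSeq‖ * ‖d‖ := by
  calc _ ≤ ∑ n ∈ Finset.range N, |invSeq n| * |d n| := by
        refine Finset.sum_le_sum fun n _ => ?_
        rw [norm_smul, Real.norm_eq_abs, div_eq_mul_one_div, abs_mul, mul_comm |d n|]
        exact mul_le_of_le_one_right (by positivity) (norm_sineBCF_le n)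
    _ ≤ √(∑ n ∈ Finset.range N, |invSeq n| ^ 2) * √(∑ n ∈ Finset.range N, |d n| ^ 2) :=
        Real.sum_mul_le_sqrt_mul_sqrt _ _ _
    _ ≤ _ := by
        simp only [sq_abs]
        gcongr
        · exact Real.sqrt_le_iff.2 ⟨norm_nonneg _, ell2.sum_sq_le _ _⟩
        · exact Real.sqrt_le_iff.2 ⟨norm_nonneg _, ell2.sum_sq_le _ _⟩

theorem summable_norm_smul_sineBCF (d : ell2) :
    Summable fun n => ‖(d n / ((n : ℝ) + 1)) • sineBCF n‖ :=
  summable_of_sum_range_le (fun _ => norm_nonneg _) (sum_norm_smul_sineBCF_le d)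

/-- The bounded continuous odd function whose derivative has the cosine coefficients `d`. -/
noncomputable def primitiveBCF : ell2 →L[ℝ] BoundedContinuousFunction ℝ ℝ :=
  LinearMap.mkContinuous
    { toFun := fun d => ∑' n, (d n / ((n : ℝ) + 1)) • sineBCF n
      map_add' := fun d d' => by
        rw [← (summable_norm_smul_sineBCF d).of_norm.tsum_add
          (summable_norm_smul_sineBCF d').of_norm]
        refine tsum_congr fun n => ?_
        rw [lp.coeFn_add, Pi.add_apply, add_div, add_smul]
      map_smul' := fun c d => by
        rw [RingHom.id_apply, ← (summable_norm_smul_sineBCF d).of_norm.tsum_const_smul]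
        refine tsum_congr fun n => ?_
        rw [lp.coeFn_smul, Pi.smul_apply, smul_eq_mul, mul_div_assoc, mul_smul] } ‖invSeq‖
    fun d => (norm_tsum_le_tsum_norm (summable_norm_smul_sineBCF d)).trans
      ((summable_norm_smul_sineBCF d).tsum_le_of_sum_range_le (sum_norm_smul_sineBCF_le d))

theorem toLp_primitiveBCF {c d : ell2} (h : ∀ n, d n = ((n : ℝ) + 1) * c n) :
    BoundedContinuousFunction.toLp 2 mu ℝ (primitiveBCF d) = sineSeries c := by
  have h1 := (summable_norm_smul_sineBCF d).of_norm.hasSum.mapL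
    (BoundedContinuousFunction.toLp (E := ℝ) 2 mu ℝ)
  refine h1.unique ((hasSum_synth orthonormal_eigenfunction c).congr_fun ?_)
  intro n
  have h2 : BoundedContinuousFunction.toLp 2 mu ℝ (sineBCF n) = eigenfunction n := rfl
  rw [map_smul, h2, h]
  congr 1
  field_simp

theorem primitiveBCF_ae_eq {c d : ell2} (h : ∀ n, d n = ((n : ℝ) + 1) * c n) :
    sineSeries c =ᵐ[mu] primitiveBCF d := by
  rw [← toLp_primitiveBCF h]
  exact BoundedContinuousFunction.coeFn_toLp (p := 2) (μ := mu) ℝ (primitiveBCF d)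

/-- The product of the primitive (with vanishing mean) of a cosine series with another
cosine series, as a bounded bilinear map of the coefficients. -/
noncomputable def primitiveMul : ell2 →L[ℝ] ell2 →L[ℝ] L2 :=
  ((ContinuousLinearMap.mul ℝ ℝ).holderL mu ∞ 2 2).bilinearComp
    ((BoundedContinuousFunction.toLp ∞ mu ℝ).comp primitiveBCF) cosineSeries.toContinuousLinearMap

theorem coeFn_primitiveMul {c d : ell2} (h : ∀ n, d n = ((n : ℝ) + 1) * c n) (d' : ell2) :
    primitiveMul d d' =ᵐ[mu] fun x => sineSeries c x * cosineSeries d' x := by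
  have h1 : primitiveMul d d' =ᵐ[mu] fun x =>
      (BoundedContinuousFunction.toLp ∞ mu ℝ (primitiveBCF d)) x * cosineSeries d' x :=
    (ContinuousLinearMap.mul ℝ ℝ).coeFn_holder _ _
  filter_upwards [h1, primitiveBCF_ae_eq h,
    BoundedContinuousFunction.coeFn_toLp (p := ∞) (μ := mu) ℝ (primitiveBCF d)] with x h2 h3 h4
  rw [h2, h3, h4]

theorem primitiveMul_mem {c d : ell2} (h : ∀ n, d n = ((n : ℝ) + 1) * c n) (d' : ell2) :
    primitiveMul d d' ∈ L2op := by
  have h1 : ∀ᵐ x ∂mu, sineSeries c (-x) = -sineSeries c x := sineSeries_mem c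
  have h2 := coeFn_reflect (cosineSeries d')
  rw [reflect_cosineSeries] at h2
  have h3 := coeFn_primitiveMul h d'
  change ∀ᵐ x ∂mu, primitiveMul d d' (-x) = -primitiveMul d d' x
  filter_upwards [h1, h2, h3, measurePreserving_neg_mu.quasiMeasurePreserving.ae h3]
    with x h4 h5 h6 h7
  rw [h7, h6, h4, ← h5, neg_mul]

/-! ### Conservation of energy -/

theorem sum_smul_ofCont {φ : ℕ → ℝ → ℝ} (hφ : ∀ n, Continuous (φ n)) (c : ℕ → ℝ)
    (s : Finset ℕ) : ∑ n ∈ s, c n • ofCont (φ n) (hφ n) =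
      ofCont (fun x => ∑ n ∈ s, c n * φ n x) (continuous_finsetSum _ fun n _ => (hφ n).const_mul _)
      := by
  refine Lp.ext ?_
  refine EventuallyEq.trans ?_ (coeFn_ofCont _).symm
  induction s using Finset.induction_on with
  | empty => simp only [Finset.sum_empty]; exact Lp.coeFn_zero ℝ 2 mu
  | insert n s hn ih =>
    rw [Finset.sum_insert hn]
    filter_upwards [ih, Lp.coeFn_add (c n • ofCont (φ n) (hφ n))
        (∑ n ∈ s, c n • ofCont (φ n) (hφ n)),
      Lp.coeFn_smul (c n) (ofCont (φ n) (hφ n)), coeFn_ofCont (hφ n)] with x h1 h2 h3 h4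
    rw [h2, Pi.add_apply, h1, h3, Pi.smul_apply, h4, Finset.sum_insert hn, smul_eq_mul]

theorem synth_sum_single {v : ℕ → L2} (hv : Orthonormal ℝ v) (c : ℕ → ℝ) (s : Finset ℕ) :
    synth hv (∑ n ∈ s, lp.single 2 n (c n)) = ∑ n ∈ s, c n • v n := by
  rw [map_sum]
  refine Finset.sum_congr rfl fun n _ => ?_
  rw [← synth_single hv, ← map_smul, ← lp.single_smul, smul_eq_mul, mul_one]

theorem integral_sq_mul_deriv_of_isTest {φ : ℝ → ℝ} (hφ : IsTest φ) :
    ∫ x in (-Real.pi)..Real.pi, φ x * (φ x * deriv φ x) = 0 := by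
  have h1 : ∀ x, HasDerivAt (fun x => φ x ^ 3 / 3) (φ x * (φ x * deriv φ x)) x := fun x =>
    (((hφ.differentiable x).hasDerivAt.fun_pow 3).div_const 3).congr_deriv (by push_cast; ring)
  have := hφ.continuous
  have := hφ.deriv.continuous
  rw [intervalIntegral.integral_eq_sub_of_hasDerivAt (fun x _ => h1 x)
    (Continuous.intervalIntegrable (by fun_prop) _ _)]
  have h2 : φ Real.pi = φ (-Real.pi) := by
    rw [← hφ.2 (-Real.pi)]; congr 1; ring
  rw [h2, sub_self]

theorem isTest_sum_sine (c : ℕ → ℝ) (s : Finset ℕ) : IsTest fun x => ∑ n ∈ s, c n * sine n x := by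
  refine ⟨ContDiff.sum fun n _ => contDiff_const.mul (isTest_sine n).1, fun x => ?_⟩
  exact Finset.sum_congr rfl fun n _ => by rw [(isTest_sine n).2]

theorem inner_primitiveMul_finite (k c : ℕ → ℝ) (hk : ∀ n, k n = ((n : ℝ) + 1) * c n)
    (s : Finset ℕ) :
    inner ℝ (sineSeries (∑ n ∈ s, lp.single 2 n (c n)))
      (primitiveMul (∑ n ∈ s, lp.single 2 n (k n)) (∑ n ∈ s, lp.single 2 n (k n))) = 0 := by
  set C : ell2 := ∑ n ∈ s, lp.single 2 n (c n)
  set D : ell2 := ∑ n ∈ s, lp.single 2 n (k n)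
  have hCD : ∀ n, D n = ((n : ℝ) + 1) * C n := by
    intro n
    simp only [C, D, lp.coeFn_sum, Finset.sum_apply, lp.single_apply, Pi.single_apply,
      Finset.mul_sum, hk, mul_ite, mul_zero]
    refine Finset.sum_congr rfl fun m _ => ?_
    split_ifs with h
    · rw [h]
    · rfl
  have hp := isTest_sum_sine c s
  set p : ℝ → ℝ := fun x => ∑ n ∈ s, c n * sine n x
  have h1 : sineSeries C = ofCont p hp.continuous := by
    rw [sineSeries, synth_sum_single]
    exact sum_smul_ofCont continuous_sine _ _
  have h2 : cosineSeries D = ofCont (deriv p) hp.deriv.continuous := by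
    have h3 := isWeakDeriv_synth orthonormal_eigenfunction orthonormal_cosineL2
      isWeakDeriv_eigenfunction hCD
    rw [← sineSeries, h1] at h3
    exact h3.unique (isWeakDeriv_ofCont hp)
  rw [h1, inner_ofCont, ← integral_sq_mul_deriv_of_isTest hp, ← integral_mu]
  refine integral_congr_ae ?_
  have h4 := coeFn_primitiveMul hCD D
  rw [h1, h2] at h4
  filter_upwards [h4, coeFn_ofCont hp.continuous, coeFn_ofCont hp.deriv.continuous]
    with x h5 h6 h7
  rw [h5, h6, h7, mul_comm]

/-- For a sine polynomial $p$, $\int p\cdot pp'=\int(p^3/3)'=0$ by periodicity. The general case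
follows by truncating both sequences, since the sup bound makes the expression continuous on
$\ell^2$. -/
theorem inner_primitiveMul_self {c d : ell2} (h : ∀ n, d n = ((n : ℝ) + 1) * c n) :
    inner ℝ (sineSeries c) (primitiveMul d d) = 0 := by
  have h1 := (lp.hasSum_single (p := 2) (by norm_num) c).tendsto_sum_nat
  have h2 := (lp.hasSum_single (p := 2) (by norm_num) d).tendsto_sum_nat
  have h3 : Continuous fun z : ell2 × ell2 => inner ℝ (sineSeries z.1) (primitiveMul z.2 z.2) := by
    have := sineSeries.continuous
    fun_prop
  refine tendsto_nhds_unique ((h3.tendsto (c, d)).comp (h1.prodMk_nhds h2)) ?_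
  refine tendsto_const_nhds.congr fun N => ?_
  exact (inner_primitiveMul_finite _ _ h _).symm

/-! ### The operator `A₁` in coordinates -/

/-- The eigenvalues of `A₁^{1/2}`. -/
noncomputable def rootEigenvalue (α a : ℝ) (n : ℕ) : ℝ := (eigenvalue α n + a) ^ (1 / 2 : ℝ)

section Eigenvalues

variable {α a : ℝ}

/-- If $a\ge2$, the term $a-2$ is dropped; otherwise $a-2\ge(a-2)k^2$ because $k\ge1$. -/
theorem mul_sq_le_eigenvalue_add (n : ℕ) :
    min α (α + a - 2) * ((n : ℝ) + 1) ^ 2 ≤ eigenvalue α n + a := by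
  have h1 : (1 : ℝ) ≤ ((n : ℝ) + 1) ^ 2 := one_le_pow₀ (by linarith [n.cast_nonneg (α := ℝ)])
  rw [eigenvalue]
  rcases le_total 2 a with h | h
  · nlinarith [min_le_left α (α + a - 2)]
  · nlinarith [min_le_right α (α + a - 2)]

theorem min_pos_of_lt (hα : 0 < α) (ha : 2 < α + a) : 0 < min α (α + a - 2) :=
  lt_min hα (by linarith)

theorem eigenvalue_add_pos (hα : 0 < α) (ha : 2 < α + a) (n : ℕ) : 0 < eigenvalue α n + a :=
  (mul_pos (min_pos_of_lt hα ha) (by positivity)).trans_le (mul_sq_le_eigenvalue_add n)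

theorem rootEigenvalue_pos (hα : 0 < α) (ha : 2 < α + a) (n : ℕ) : 0 < rootEigenvalue α a n :=
  Real.rpow_pos_of_pos (eigenvalue_add_pos hα ha n) _

theorem rootEigenvalue_sq (hα : 0 < α) (ha : 2 < α + a) (n : ℕ) :
    rootEigenvalue α a n ^ 2 = eigenvalue α n + a := by
  rw [rootEigenvalue, ← Real.sqrt_eq_rpow, Real.sq_sqrt (eigenvalue_add_pos hα ha n).le]

theorem tendsto_rootEigenvalue_sq (hα : 0 < α) (ha : 2 < α + a) :
    Tendsto (fun n => rootEigenvalue α a n ^ 2) atTop atTop := by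
  have h1 := tendsto_natCast_atTop_atTop (R := ℝ) |>.const_mul_atTop (min_pos_of_lt hα ha)
  refine tendsto_atTop_mono (fun n => ?_) h1
  rw [rootEigenvalue_sq hα ha]
  refine le_trans ?_ (mul_sq_le_eigenvalue_add n)
  have := min_pos_of_lt hα ha
  gcongr
  nlinarith [n.cast_nonneg (α := ℝ)]

theorem abs_wavenumber_div_le (hα : 0 < α) (ha : 2 < α + a) (n : ℕ) :
    |((n : ℝ) + 1) / rootEigenvalue α a n| ≤ √(1 / min α (α + a - 2)) := by
  refine Real.abs_le_sqrt ?_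
  rw [div_pow, rootEigenvalue_sq hα ha, div_le_div_iff₀ (eigenvalue_add_pos hα ha n)
    (min_pos_of_lt hα ha), one_mul, mul_comm]
  exact mul_sq_le_eigenvalue_add n

theorem abs_div_wavenumber_le (hα : 0 < α) (ha : 2 < α + a) (n : ℕ) :
    |rootEigenvalue α a n / ((n : ℝ) + 1)| ≤ √(α + |a|) := by
  refine Real.abs_le_sqrt ?_
  have h1 : (1 : ℝ) ≤ ((n : ℝ) + 1) ^ 2 := one_le_pow₀ (by linarith [n.cast_nonneg (α := ℝ)])
  rw [div_pow, rootEigenvalue_sq hα ha, div_le_iff₀ (by positivity), eigenvalue]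
  nlinarith [le_abs_self a, abs_nonneg a]

/-- In coordinates `i` is the inclusion of $\mathcal B^{1/2}$ in $L^2$, `D` gives the cosine
coefficients of $z'$, and `E` turns the coefficients of $A_1z$ into those of $-z''$. All are bounded
since $k/\sigma_n$ is. -/
theorem exists_diag_inclusion (hα : 0 < α) (ha : 2 < α + a) :
    ∃ i D E : ell2 →L[ℝ] ell2, (∀ y n, y n = rootEigenvalue α a n * i y n) ∧
      (∀ y n, D y n = ((n : ℝ) + 1) * i y n) ∧
      ∀ w n, rootEigenvalue α a n ^ 2 * E w n = ((n : ℝ) + 1) ^ 2 * w n := by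
  have hb := abs_wavenumber_div_le hα ha
  have h1 : ∀ n : ℕ, |1 / rootEigenvalue α a n| ≤ √(1 / min α (α + a - 2)) := fun n => by
    refine le_trans ?_ (hb n)
    rw [abs_of_pos (one_div_pos.2 (rootEigenvalue_pos hα ha n)),
      abs_of_pos (div_pos (by positivity) (rootEigenvalue_pos hα ha n))]
    have := rootEigenvalue_pos hα ha n
    gcongr
    linarith [n.cast_nonneg (α := ℝ)]
  have h2 : ∀ n : ℕ, |(((n : ℝ) + 1) / rootEigenvalue α a n) ^ 2| ≤
      √(1 / min α (α + a - 2)) ^ 2 := fun n => by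
    rw [abs_pow]
    gcongr
    exact hb n
  refine ⟨ell2.diag _ _ h1, ell2.diag _ _ hb, ell2.diag _ _ h2, fun y n => ?_, fun y n => ?_,
    fun w n => ?_⟩
  all_goals
    have := (rootEigenvalue_pos hα ha n).ne'
    simp only [ell2.diag_apply]
    field_simp

end Eigenvalues

variable {α a : ℝ}

theorem powCoeff_half (f : L2) (n : ℕ) :
    powCoeff α a (1 / 2) f n = rootEigenvalue α a n * inner ℝ (eigenfunction n) f := rfl

theorem sineSeries_eq_of_inner {f : L2} (hf : f ∈ L2op) {c : ell2}
    (h : ∀ n, inner ℝ (eigenfunction n) f = c n) : sineSeries c = f := by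
  rw [← sineSeries_sineCoeffs hf]
  congr 1
  ext n
  rw [coeffs_apply, h]

theorem isWeakDeriv_series {c d : ell2} (h : ∀ n, d n = ((n : ℝ) + 1) * c n) :
    IsWeakDeriv (sineSeries c) (cosineSeries d) :=
  isWeakDeriv_synth _ _ isWeakDeriv_eigenfunction h

/-- The space `B^{1/2}` is the Sobolev space of odd periodic functions. -/
theorem powDomain_half_eq_H1op (hα : 0 < α) (ha : 2 < α + a) :
    (powDomain α a (1 / 2) : Set L2) = H1op := by
  ext f
  constructor
  · rintro ⟨hf, hm⟩
    obtain ⟨i, D, -, hi, hD, -⟩ := exists_diag_inclusion hα ha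
    let y : ell2 := ⟨_, hm⟩
    have h1 : sineSeries (i y) = f := sineSeries_eq_of_inner hf fun n =>
      mul_left_cancel₀ (rootEigenvalue_pos hα ha n).ne' (hi y n)
    refine ⟨hf, cosineSeries (D y), ?_⟩
    rw [← h1]
    exact isWeakDeriv_series (hD y)
  · rintro ⟨hf, g, hg⟩
    refine ⟨hf, ?_⟩
    -- The coordinates are the cosine coefficients of the weak derivative times the bounded
    -- multiplier $\sigma_n/k$.
    have h1 : powCoeff α a (1 / 2) f = ell2.diag _ _ (abs_div_wavenumber_le hα ha)
        (coeffs orthonormal_cosineL2 g) := by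
      funext n
      rw [ell2.diag_apply, coeffs_apply, hg.inner_cosineL2, powCoeff_half]
      field_simp
    rw [h1]
    exact lp.memℓp _

/-! ### The space `B^{1/2}` in coordinates -/

theorem B.norm_def {γ : ℝ} (f : B α a γ) : ‖f‖ = ‖B.pow f‖ := rfl

theorem B.isometry_pow {γ : ℝ} : Isometry (B.pow (α := α) (a := a) (γ := γ)) :=
  Isometry.of_dist_eq fun f g => by
    rw [dist_eq_norm, dist_eq_norm, B.norm_def, map_sub]

theorem B.pow_half_apply (f : B α a (1 / 2)) (n : ℕ) :
    B.pow f n = rootEigenvalue α a n * inner ℝ (eigenfunction n) f.toL2 := rfl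

theorem B.toL2_mem (f : B α a (1 / 2)) : f.toL2 ∈ L2op := f.2.1

theorem B.toL2_injective : Function.Injective (B.toL2 : B α a (1 / 2) → L2) :=
  Subtype.val_injective

section Coordinates

variable {i D E : ell2 →L[ℝ] ell2}

theorem B.toL2_eq (hα : 0 < α) (ha : 2 < α + a)
    (hi : ∀ y n, y n = rootEigenvalue α a n * i y n) (f : B α a (1 / 2)) :
    f.toL2 = sineSeries (i (B.pow f)) :=
  (sineSeries_eq_of_inner f.toL2_mem fun n =>
    mul_left_cancel₀ (rootEigenvalue_pos hα ha n).ne' (by rw [← hi, B.pow_half_apply])).symm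

/-- The element of `B^{1/2}` with the given coordinates. -/
noncomputable def B.ofCoords (hi : ∀ y n, y n = rootEigenvalue α a n * i y n) (y : ell2) :
    B α a (1 / 2) :=
  ⟨sineSeries (i y), sineSeries_mem _, by
    have : powCoeff α a (1 / 2) (sineSeries (i y)) = y := by
      funext n
      rw [powCoeff_half, inner_synth, hi y n]
    rw [this]
    exact lp.memℓp y⟩

theorem B.toL2_ofCoords (hi : ∀ y n, y n = rootEigenvalue α a n * i y n) (y : ell2) :
    (B.ofCoords hi y).toL2 = sineSeries (i y) := rfl

theorem B.pow_ofCoords (hi : ∀ y n, y n = rootEigenvalue α a n * i y n) (y : ell2) :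
    B.pow (B.ofCoords hi y) = y := by
  ext n
  rw [B.pow_half_apply, B.toL2_ofCoords, inner_synth, ← hi]

theorem B.ofCoords_pow (hα : 0 < α) (ha : 2 < α + a)
    (hi : ∀ y n, y n = rootEigenvalue α a n * i y n) (f : B α a (1 / 2)) :
    B.ofCoords hi (B.pow f) = f :=
  B.toL2_injective (by rw [B.toL2_ofCoords, ← B.toL2_eq hα ha hi])

theorem B.continuous_ofCoords (hi : ∀ y n, y n = rootEigenvalue α a n * i y n) :
    Continuous (B.ofCoords hi) := by
  refine (Isometry.of_dist_eq fun y y' => ?_).continuous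
  rw [← B.isometry_pow.dist_eq, B.pow_ofCoords, B.pow_ofCoords]

/-! ### The Burgers nonlinearity, and the passage between solutions and mild solutions. -/

/-- The bilinear form, in coordinates, whose diagonal is the nonlinearity `-2 α z z'`. -/
noncomputable def burgersForm (α : ℝ) (D : ell2 →L[ℝ] ell2) : ell2 →L[ℝ] ell2 →L[ℝ] ell2 :=
  (-2 * α) • (ContinuousLinearMap.compL ℝ ell2 L2 ell2 sineCoeffs).comp
    (primitiveMul.bilinearComp D D)

theorem burgersForm_apply (y y' : ell2) :
    burgersForm α D y y' = (-2 * α) • sineCoeffs (primitiveMul (D y) (D y')) := rfl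

theorem inner_burgersForm (hD : ∀ y n, D y n = ((n : ℝ) + 1) * i y n) (y : ell2) :
    inner ℝ (i y) (burgersForm α D y y) = 0 := by
  rw [burgersForm_apply, inner_smul_right, inner_coeffs, inner_primitiveMul_self (hD y), mul_zero]

theorem coeFn_burgersForm (hD : ∀ y n, D y n = ((n : ℝ) + 1) * i y n) (y : ell2) :
    sineSeries (burgersForm α D y y) =ᵐ[mu]
      fun x => -2 * α * sineSeries (i y) x * cosineSeries (D y) x := by
  rw [burgersForm_apply, map_smul, sineSeries_sineCoeffs (primitiveMul_mem (hD y) _)]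
  filter_upwards [Lp.coeFn_smul (-2 * α) (primitiveMul (D y) (D y)),
    coeFn_primitiveMul (hD y) (D y)] with x h1 h2
  rw [h1, Pi.smul_apply, h2, smul_eq_mul, mul_assoc (-2 * α)]

theorem isF_burgersForm (hD : ∀ y n, D y n = ((n : ℝ) + 1) * i y n) (y : ell2) :
    IsF α (sineSeries (i y)) (sineSeries (burgersForm α D y y)) :=
  ⟨cosineSeries (D y), isWeakDeriv_series (hD y), coeFn_burgersForm hD y⟩

theorem IsF.eq_burgersForm (hD : ∀ y n, D y n = ((n : ℝ) + 1) * i y n) {y : ell2} {F : L2}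
    (h : IsF α (sineSeries (i y)) F) : F = sineSeries (burgersForm α D y y) := by
  obtain ⟨g, hg, hF⟩ := h
  have h1 := hg.unique (isWeakDeriv_series (hD y))
  rw [h1] at hF
  exact Lp.ext (EventuallyEq.trans hF (coeFn_burgersForm hD y).symm)

theorem IsA.inner_eigenfunction {f g : L2} (h : IsA α f g) (n : ℕ) :
    inner ℝ (eigenfunction n) g = eigenvalue α n * inner ℝ (eigenfunction n) f := by
  obtain ⟨-, k, hk, rfl⟩ := h
  rw [inner_sub_right, inner_neg_right, inner_smul_right, inner_smul_right,
    hk.inner_eigenfunction, eigenvalue]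
  ring

/-- Square summability of $w=A_1z$ puts $z$ in $D(A)$: differentiating the sine series to a cosine
series and back gives the second weak derivative. -/
theorem isA_of_coords (hα : 0 < α) (ha : 2 < α + a)
    (hi : ∀ y n, y n = rootEigenvalue α a n * i y n)
    (hD : ∀ y n, D y n = ((n : ℝ) + 1) * i y n)
    (hE : ∀ w n, rootEigenvalue α a n ^ 2 * E w n = ((n : ℝ) + 1) ^ 2 * w n) {y w : ell2}
    (hw : ∀ n, w n = rootEigenvalue α a n * y n) :
    IsA α (sineSeries (i y)) (sineSeries (w - a • i y)) := by
  have hEw : ∀ n, E w n = ((n : ℝ) + 1) * D y n := fun n => by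
    have h1 := rootEigenvalue_pos hα ha n
    refine mul_left_cancel₀ (pow_pos h1 2).ne' ?_
    rw [hE, hw, hD]
    nth_rewrite 1 [hi y n]
    ring
  refine ⟨sineSeries_mem _, sineSeries (-E w), (isWeakDeriv_series (hD y)).isWeakDeriv₂
    (isWeakDeriv_synth _ _ isWeakDeriv_cosineL2 fun n => ?_), ?_⟩
  · rw [lp.coeFn_neg, Pi.neg_apply, hEw, neg_mul]
  · rw [← sineSeries.map_smul, ← sineSeries.map_smul, ← sineSeries.map_neg,
      ← sineSeries.map_sub]
    congr 1
    ext n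
    simp only [lp.coeFn_sub, lp.coeFn_smul, lp.coeFn_neg, Pi.sub_apply, Pi.smul_apply,
      Pi.neg_apply, smul_eq_mul, hEw, hD]
    rw [hw, hi y n]
    have h2 := rootEigenvalue_sq hα ha n
    rw [eigenvalue] at h2
    linear_combination (i y n) * h2

/-- A mild solution in coordinates defines a solution in `B^{1/2}`. -/
theorem isSolution_ofCoords (hα : 0 < α) (ha : 2 < α + a)
    (hi : ∀ y n, y n = rootEigenvalue α a n * i y n)
    (hD : ∀ y n, D y n = ((n : ℝ) + 1) * i y n)
    (hE : ∀ w n, rootEigenvalue α a n ^ 2 * E w n = ((n : ℝ) + 1) ^ 2 * w n)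
    {z₀ : B α a (1 / 2)} {y : ℝ → ell2} (hy : Continuous y) (hy0 : y 0 = B.pow z₀)
    (h : ∀ T, IsMild (rootEigenvalue α a) T y
      fun t => burgersForm α D (y t) (y t) + a • i (y t)) :
    IsSolution α a z₀ fun t => B.ofCoords hi (y t) := by
  refine ⟨by rw [hy0, B.ofCoords_pow hα ha hi],
    ((B.continuous_ofCoords hi).comp hy).continuousOn, fun t ht => ?_⟩
  obtain ⟨R, hR⟩ := exists_norm_le_on_Icc hy (t + 1)
  obtain ⟨q, hq, hder⟩ := (h (t + 1)).exists_hasDerivAt hi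
    (fun n => (rootEigenvalue_pos hα ha n).ne') hy
    ((continuous_quadratic (burgersForm α D) a i).comp hy)
    (fun s hs r hr => norm_quadratic_sub_le (hR s hs) (hR r hr)) ⟨ht, lt_add_one t⟩
  set G := burgersForm α D (y t) (y t) + a • i (y t)
  -- Here $q=G-A_1z$, so $G-q-az=Az$.
  refine ⟨sineSeries q, sineSeries (G - q - a • i (y t)),
    sineSeries (burgersForm α D (y t) (y t)), ?_, ?_, isF_burgersForm hD (y t), ?_⟩
  · exact (sineSeries.toContinuousLinearMap.hasFDerivAt.comp_hasDerivAt t hder)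
  · refine isA_of_coords hα ha hi hD hE fun n => ?_
    rw [lp.coeFn_sub, Pi.sub_apply, hq]
    exact sub_sub_cancel _ _
  · rw [← map_add]
    congr 1
    simp only [G]
    abel

/-- The coordinates of a solution in `B^{1/2}` form a mild solution. -/
theorem IsSolution.isMild_pow (hα : 0 < α) (ha : 2 < α + a)
    (hi : ∀ y n, y n = rootEigenvalue α a n * i y n)
    (hD : ∀ y n, D y n = ((n : ℝ) + 1) * i y n)
    {z₀ : B α a (1 / 2)} {w : ℝ → B α a (1 / 2)} (h : IsSolution α a z₀ w) (T : ℝ) :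
    IsMild (rootEigenvalue α a) T (fun t => B.pow (w (max t 0))) fun t =>
      burgersForm α D (B.pow (w (max t 0))) (B.pow (w (max t 0))) +
        a • i (B.pow (w (max t 0))) := by
  intro t ht n
  obtain ⟨v, Az, Fz, hv, hA, hF, heq⟩ := h.equation t ht.1
  simp only [max_eq_left ht.1.le]
  set y := B.pow (w t)
  have h1 : HasDerivAt (fun s => rootEigenvalue α a n * inner ℝ (eigenfunction n) (w s).toL2)
      (rootEigenvalue α a n * inner ℝ (eigenfunction n) v) t :=
    ((innerSL ℝ (eigenfunction n)).hasFDerivAt.comp_hasDerivAt t hv).const_mul _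
  have h2 : (fun s => B.pow (w (max s 0)) n) =ᶠ[𝓝 t]
      fun s => rootEigenvalue α a n * inner ℝ (eigenfunction n) (w s).toL2 := by
    filter_upwards [Ioi_mem_nhds ht.1] with s hs
    rw [max_eq_left (le_of_lt hs), B.pow_half_apply]
  refine (h1.congr_of_eventuallyEq h2).congr_deriv ?_
  rw [B.toL2_eq hα ha hi] at hF
  have h3 := hF.eq_burgersForm hD
  have h4 : inner ℝ (eigenfunction n) (w t).toL2 = i y n := by
    rw [B.toL2_eq hα ha hi, inner_synth]
  rw [eq_sub_of_add_eq heq, inner_sub_right, hA.inner_eigenfunction, h3, inner_synth, h4,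
    lp.coeFn_add, Pi.add_apply, lp.coeFn_smul, Pi.smul_apply, smul_eq_mul, hi y n,
    rootEigenvalue_sq hα ha]
  ring

end Coordinates

end OddBurgers

/-! ### The theorem, transported from coordinates. -/

theorem theorem3p1 (α a : ℝ) (hα : 0 < α) (ha : 2 < α + a) :
    (OddBurgers.powDomain α a (1 / 2) : Set OddBurgers.L2) = OddBurgers.H1op ∧
    ∀ z₀ : OddBurgers.B α a (1 / 2), ∃ z : ℝ → OddBurgers.B α a (1 / 2),
      OddBurgers.IsSolution α a z₀ z ∧
      (∀ w : ℝ → OddBurgers.B α a (1 / 2), OddBurgers.IsSolution α a z₀ w →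
        ∀ t : ℝ, 0 ≤ t → w t = z t) ∧
      ((∃ M : ℝ, ∀ᶠ t in Filter.atTop, ‖z t‖ ≤ M) →
        ∃ K : Set (OddBurgers.B α a (1 / 2)), IsCompact K ∧ ∀ t : ℝ, 0 ≤ t → z t ∈ K) := by
  open OddBurgers in
  refine ⟨powDomain_half_eq_H1op hα ha, fun z₀ => ?_⟩
  obtain ⟨i, D, E, hi, hD, hE⟩ := exists_diag_inclusion hα ha
  have hσ : ∀ n, rootEigenvalue α a n ≠ 0 := fun n => (rootEigenvalue_pos hα ha n).ne'
  obtain ⟨y, hy, hy0, hmild⟩ := exists_isMild_quadratic (a := a) (B := burgersForm α D) hi hσ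
    (inner_burgersForm hD) (B.pow z₀)
  refine ⟨fun t => B.ofCoords hi (y t), isSolution_ofCoords hα ha hi hD hE hy hy0 hmild,
    fun w hw t ht => ?_, ?_⟩
  · have hwc : Continuous fun t => B.pow (w (max t 0)) :=
      B.isometry_pow.continuous.comp (hw.continuousOn.comp_continuous
        (continuous_id.max continuous_const) fun t => mem_Ici.2 (le_max_right _ _))
    have h1 := IsMild.unique hwc hy (hw.isMild_pow hα ha hi hD t) (hmild t)
      (by rw [max_self, hw.initial, hy0]) t ⟨ht, le_rfl⟩
    rw [max_eq_left ht] at h1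
    change w t = B.ofCoords hi (y t)
    rw [← h1, B.ofCoords_pow hα ha hi]
  · rintro ⟨M, hM⟩
    obtain ⟨T, hT⟩ := eventually_atTop.1 hM
    obtain ⟨R', hR'⟩ := exists_norm_le_on_Icc hy T
    have hR : ∀ t, 0 ≤ t → ‖y t‖ ≤ max M R' := fun t ht => by
      rcases le_total T t with h1 | h1
      · have h2 := hT t h1
        rw [B.norm_def, B.pow_ofCoords] at h2
        exact h2.trans (le_max_left _ _)
      · exact (hR' t ⟨ht, h1⟩).trans (le_max_right _ _)
    obtain ⟨K, hK, hyK⟩ := exists_isCompact_of_isMild (tendsto_rootEigenvalue_sq hα ha) hmild hy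
      ((continuous_quadratic (burgersForm α D) a i).comp hy) hR (fun t ht => by
        -- Comparison with $x'=0$ turns the local Lipschitz estimate into a bound on the forcing.
        have h3 := norm_quadratic_sub_le (B := burgersForm α D) (a := a) (i := i) (hR t ht)
          (x' := 0) (by rw [norm_zero]; exact (norm_nonneg _).trans (hR t ht))
        simp only [map_zero, smul_zero, add_zero, sub_zero] at h3
        exact h3.trans (mul_le_mul_of_nonneg_left (hR t ht) (by
          have := (norm_nonneg _).trans (hR t ht)
          positivity)))
    exact ⟨_, hK.image (B.continuous_ofCoords hi), fun t ht => mem_image_of_mem _ (hyK t ht)⟩
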